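/- Let $n\ge 1$ and $V_0^n=\{x\in\mathbb R^n:\sum_i x_i=0\}$. An ordered set partition of a nonempty set $J\subseteq\{1,\dots,n\}$ is a sequence $\mathbf T=(B_1,\dots,B_r)$ of pairwise disjoint nonempty sets (blocks) with union $J$; put $\mathrm{len}(\mathbf T)=r$. Its plate is the cone $$[\mathbf T]=\Big\{x\in V_0^n:\ x_i=0\ (i\notin J),\ \sum_{i\in B_1\cup\cdots\cup B_j}x_i\ge 0\ (1\le j\le r)\Big\},$$ and $[[\mathbf T]]$ denotes the ($\mathbb C$-valued) characteristic function of $[\mathbf T]$; for a plate $\pi$ labelled by an ordered set partition write $[\pi]$ for its characteristic function and $\mathrm{len}(\pi)$ for the number of blocks of the label. The convolution product $\bullet$ of characteristic functions of cones is the characteristic function of the Minkowski sum of the cones: $[C_1]\bullet[C_2]=[C_1+C_2]$. A composite set partition of $J$ is a set $\{\mathbf T_1,\dots,\mathbf T_m\}$ of ordered set partitions of nonempty sets $J_1,\dots,J_m$ that form a set partition of $J$. It is standard if the first block of each $\mathbf T_a$ contains $\min J_a$; the canonical basis consists of the functions $[[\mathbf T_1]]\bullet\cdots\bullet[[\mathbf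 T_m]]$ for the standard composite set partitions of $\{1,\dots,n\}$. In an ordered set partition, $p_A<p_B$ (resp. $p_A=p_B$) means that $A$ lies in a block strictly to the left of (resp. in the same block as) $B$. Let $1\le l\le k$ and let $(S_l,S_{l-1},\dots,S_1,S_{l+1},\dots,S_k)$ be an ordered set partition of $\{1,\dots,n\}$. (a) We have $$[[S_l,\dots,S_1,S_{l+1},\dots,S_k]]=\sum_{m\ge 1}\ \sum_{\{\mathbf T_1,\dots,\mathbf T_m\}}\ \sum_{\pi}(-1)^{c}(-1)^{\mathrm{len}(\mathbf T_1)+(k-l)-\mathrm{len}(\pi)}\,[[\mathbf T_2]]\bullet\cdots\bullet[[\mathbf T_m]]\bullet[\pi],$$ where: - The sum over $\{\mathbf T_1,\dots,\mathbf T_m\}$ is over all composite set partitions of $S_1\cup\cdots\cup S_l$ that satisfy the chain of orientations $p_{S_l}\ge p_{S_{l-1}}\ge\cdots\ge p_{S_1}$. This means that each $\mathbf T_a$ is an ordered set partition of the union $S_i\cup S_{i+1}\cup\cdots\cup S_j$ of a run of consecutive sets, each of these sets is contained in a block of $\mathbf T_a$, and $p_{S_i}\le p_{S_{i+1}}\le\cdots\le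 p_{S_j}$ in $\mathbf T_a$. The numbering is chosen such that $S_1$ is contained in a block of $\mathbf T_1$. - The sum over $\pi$ is over all plates labelled by ordered set partitions of $\big(\bigcup_{U\in\mathbf T_1}U\big)\cup S_{l+1}\cup\cdots\cup S_k$ that induce $\mathbf T_1$ on $\bigcup_{U\in\mathbf T_1}U$ (any two labels in this set are in the same block, respectively in the same strict order, for $\pi$ exactly when they are so for $\mathbf T_1$), have each of $S_{l+1},\dots,S_k$ contained in a block, and satisfy $p_{S_1}<p_{S_{l+1}}<\cdots<p_{S_k}$. - $c$ is the number of $i\in\{1,\dots,l-1\}$ such that $S_i$ and $S_{i+1}$ belong to the same $\mathbf T_a$ with the strict orientation $p_{S_i}<p_{S_{i+1}}$. (b) For each term of this sum, $\{\mathbf T_2,\dots,\mathbf T_m,\pi\}$ is a composite set partition of $\{1,\dots,n\}$ that is standard with respect to the enumeration $S_1,\dots,S_k$: the first block of each member contains the set $S_i$ of smallest index $i$ among those contained in the union of the blocks of that member. (c) In particular, if $\min S_1<\min S_2<\cdots<\min S_l$ and $\min S_1<\min S_j$ for $l<j\le k$, then each term $[[\mathbf T_2]]\bullet\cdots\bullet[[\mathbf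 T_m]]\bullet[\pi]$ is a member of the canonical basis. -/

import Mathlib

open scoped Pointwise

/-- An ordered set partition of a nonempty subset of the label set `Fin n`: a nonempty list of
pairwise disjoint nonempty blocks. -/
structure OSP (n : ℕ) where
  blocks : List (Finset (Fin n))
  ne_nil : blocks ≠ []
  nonempty_of_mem : ∀ B ∈ blocks, B.Nonempty
  disjoint : blocks.Pairwise Disjoint

namespace OSP

variable {n : ℕ}

/-- The set which is partitioned: the union of all the blocks. -/
def carrier (T : OSP n) : Finset (Fin n) := T.blocks.toFinset.sup id

/-- The number of blocks. -/
def len (T : OSP n) : ℕ := T.blocks.length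

/-- `T.pos x` is the (zero-based) position of the block containing the label `x`, for
`x ∈ T.carrier`. -/
def pos (T : OSP n) (x : Fin n) : ℕ := T.blocks.findIdx (fun B => decide (x ∈ B))

/-- The plate labelled by an ordered set partition `(B₁, …, B_r)` of `J ⊆ {1, …, n}`: the cone of
all `x ∈ ℝⁿ`, zero outside `J`, whose coordinates sum to zero, such that the sum of the coordinates
over `B₁ ∪ ⋯ ∪ B_j` is nonnegative for each `j`. -/
def plate (T : OSP n) : Set (Fin n → ℝ) :=
  {x | (∀ i, i ∉ T.carrier → x i = 0) ∧ ∑ i ∈ T.carrier, x i = 0 ∧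
    ∀ j : ℕ, 0 ≤ ((T.blocks.take j).map (fun B => ∑ i ∈ B, x i)).sum}

/-- The first block contains the minimal label. -/
def IsStandard (T : OSP n) : Prop :=
  ∃ B ∈ T.blocks.head?, ∃ a ∈ B, ∀ x ∈ T.carrier, a ≤ x

/-- The analogue of `IsStandard` for the enumeration `S₁, …, S_k` of a family of sets of labels in
place of the natural order of the labels: the first block contains the set `S_i` of smallest
index `i` among those that are contained in the carrier. -/
def IsStandardFor (S : ℕ → Finset (Fin n)) (k : ℕ) (T : OSP n) : Prop :=
  ∃ B ∈ T.blocks.head?, ∃ i ∈ Finset.Icc 1 k, S i ⊆ B ∧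
    ∀ j ∈ Finset.Icc 1 k, S j ⊆ T.carrier → i ≤ j

/-- All labels of `A` lie in the same block of `T`. -/
def SameBlock (T : OSP n) (A : Finset (Fin n)) : Prop :=
  ∀ x ∈ A, ∀ y ∈ A, T.pos x = T.pos y

/-- The orientation `p_A < p_B`: every label of `A` lies in a block of `T` strictly to the left of
the block of any label of `B`. -/
def BlockLT (T : OSP n) (A B : Finset (Fin n)) : Prop :=
  ∀ x ∈ A, ∀ y ∈ B, T.pos x < T.pos y

theorem blocks_nodup (T : OSP n) : T.blocks.Nodup := by
  refine T.disjoint.imp_of_mem ?_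
  intro A B hA _ hAB h
  subst h
  exact (T.nonempty_of_mem A hA).ne_empty (Finset.disjoint_self_iff_empty A |>.1 hAB)

theorem blocks_injective : Function.Injective (OSP.blocks : OSP n → List (Finset (Fin n))) := by
  rintro ⟨a, _, _, _⟩ ⟨b, _, _, _⟩ h
  simpa using h

instance : Finite (OSP n) :=
  Finite.of_injective
    (fun T : OSP n => (⟨T.blocks, T.blocks_nodup⟩ : {L : List (Finset (Fin n)) // L.Nodup}))
    (fun _ _ h => blocks_injective (congrArg Subtype.val h))

noncomputable instance : Fintype (OSP n) := Fintype.ofFinite _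

noncomputable instance : DecidableEq (OSP n) := Classical.decEq _

end OSP

section Composite

variable {n : ℕ}

/-- The characteristic function of a subset of `ℝⁿ`. -/
noncomputable def charFun (C : Set (Fin n → ℝ)) : (Fin n → ℝ) → ℂ := C.indicator 1

/-- The convolution product `[C₁] • [C₂] = [C₁ + C₂]` of the characteristic functions of two cones
is the characteristic function of their Minkowski sum.  This is the iterated convolution product of
the characteristic functions of the plates labelled by the members of `𝒯`. -/
noncomputable def convPlates (𝒯 : Finset (OSP n)) : (Fin n → ℝ) → ℂ :=
  charFun (∑ T ∈ 𝒯, T.plate)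

/-- `𝒯` is a composite set partition of `J`: a set of ordered set partitions of subsets of `J`
such that these subsets form a set partition of `J`. -/
def IsComposite (𝒯 : Finset (OSP n)) (J : Finset (Fin n)) : Prop :=
  (∀ T ∈ 𝒯, ∀ T' ∈ 𝒯, T ≠ T' → Disjoint T.carrier T'.carrier) ∧ 𝒯.sup OSP.carrier = J

/-- The canonical plate basis: the convolution products labelled by the standard composite set
partitions of the whole label set. -/
def canonicalBasis (n : ℕ) : Set ((Fin n → ℝ) → ℂ) :=
  {f | ∃ 𝒯 : Finset (OSP n),
    IsComposite 𝒯 Finset.univ ∧ (∀ T ∈ 𝒯, T.IsStandard) ∧ f = convPlates 𝒯}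

/-- `p_x < p_y` for a composite set partition: `x` and `y` are in the same member of `𝒯`, with the
block of `x` strictly to the left of the block of `y`, or they are in different members. -/
def CompositeLT (𝒯 : Finset (OSP n)) (x y : Fin n) : Prop :=
  (∃ T ∈ 𝒯, x ∈ T.carrier ∧ y ∈ T.carrier ∧ T.pos x < T.pos y) ∨
    ∃ T ∈ 𝒯, ∃ T' ∈ 𝒯, T ≠ T' ∧ x ∈ T.carrier ∧ y ∈ T'.carrier

/-- `p_x = p_y` for a composite set partition: same block of the same member. -/
def CompositeEQ (𝒯 : Finset (OSP n)) (x y : Fin n) : Prop :=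
  ∃ T ∈ 𝒯, x ∈ T.carrier ∧ y ∈ T.carrier ∧ T.pos x = T.pos y

/-- The composite set partition `𝒯` of `S₁ ∪ ⋯ ∪ S_l` satisfies the chain of orientations
`p_(S_l) ≥ ⋯ ≥ p_(S₁)`: all labels of an `S_i` are in one block, consecutive sets are related as
prescribed, and the chain of relations between two sets in the same member of `𝒯` stays inside
that member. -/
def SatisfiesChain (S : ℕ → Finset (Fin n)) (l : ℕ) (𝒯 : Finset (OSP n)) : Prop :=
  (∀ i ∈ Finset.Icc 1 l, ∀ x ∈ S i, ∀ y ∈ S i, CompositeEQ 𝒯 x y) ∧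
  (∀ i ∈ Finset.Ico 1 l,
    (∀ x ∈ S i, ∀ y ∈ S (i + 1), CompositeLT 𝒯 x y) ∨
    (∀ x ∈ S i, ∀ y ∈ S (i + 1), CompositeEQ 𝒯 x y)) ∧
  (∀ a b c : ℕ, 1 ≤ a → a ≤ b → b ≤ c → c ≤ l → ∀ T ∈ 𝒯,
    S a ⊆ T.carrier → S c ⊆ T.carrier → S b ⊆ T.carrier)

open Classical in
/-- The composite set partitions of `S₁ ∪ ⋯ ∪ S_l` satisfying `p_(S_l) ≥ ⋯ ≥ p_(S₁)`. -/
noncomputable def chainComposites (S : ℕ → Finset (Fin n)) (l : ℕ) : Finset (Finset (OSP n)) :=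
  Finset.univ.filter (fun 𝒯 =>
    IsComposite 𝒯 ((Finset.Icc 1 l).biUnion S) ∧ SatisfiesChain S l 𝒯)

/-- The members of `𝒯` whose carrier contains `S₁`; for a composite set partition
in `chainComposites S l` with `1 ≤ l` there is exactly one, which is called `T₁`. -/
def firstMembers (S : ℕ → Finset (Fin n)) (𝒯 : Finset (OSP n)) : Finset (OSP n) :=
  𝒯.filter (fun T => S 1 ⊆ T.carrier)

open Classical in
/-- The ordered set partitions `π` of `T₁ ∪ S_{l+1} ∪ ⋯ ∪ S_k` that keep all the orientations
of `T₁` (that is, induce `T₁` on its carrier) and satisfy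
`p_(S₁) < p_(S_{l+1}) < ⋯ < p_(S_k)`. -/
noncomputable def orientedPlates (S : ℕ → Finset (Fin n)) (l k : ℕ) (T₁ : OSP n) :
    Finset (OSP n) :=
  Finset.univ.filter (fun π =>
    π.carrier = T₁.carrier ∪ (Finset.Icc (l + 1) k).biUnion S ∧
    (∀ x ∈ T₁.carrier, ∀ y ∈ T₁.carrier, (π.pos x < π.pos y ↔ T₁.pos x < T₁.pos y)) ∧
    (∀ j ∈ Finset.Icc (l + 1) k, π.SameBlock (S j)) ∧
    (l < k → π.BlockLT (S 1) (S (l + 1))) ∧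
    (∀ j ∈ Finset.Ico (l + 1) k, π.BlockLT (S j) (S (j + 1))))

open Classical in
/-- The number `c` of `i ∈ {1, …, l - 1}` such that `S_i` and `S_{i+1}` are in the same member
of `𝒯` with the strict orientation `p_(S_i) < p_(S_{i+1})`. -/
noncomputable def strictCount (S : ℕ → Finset (Fin n)) (l : ℕ) (𝒯 : Finset (OSP n)) : ℕ :=
  ((Finset.Ico 1 l).filter (fun i =>
    ∃ T ∈ 𝒯, S i ⊆ T.carrier ∧ S (i + 1) ⊆ T.carrier ∧ T.BlockLT (S i) (S (i + 1)))).card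

/-- The list `(S_l, …, S₁, S_{l+1}, …, S_k)`. -/
def bentList (S : ℕ → Finset (Fin n)) (l k : ℕ) : List (Finset (Fin n)) :=
  ((List.range' 1 l).reverse ++ List.range' (l + 1) (k - l)).map S

/-- `min A < min B` (for nonempty `A`, `B`). -/
def MinLT (A B : Finset (Fin n)) : Prop := ∃ a ∈ A, ∀ b ∈ B, a < b

end Composite

/-! Both sides are evaluated at a point x. A Minkowski sum of plates with disjoint carriers splits
coordinatewise, so a composite set partition of all labels contributes a product with one factor per
member (`convPlates_apply`): the coordinates of the member sum to zero and the minimum of its prefix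
sums is nonnegative. Let Y_j be the sum of x over S_1 ∪ ⋯ ∪ S_j, let b be the least prefix sum of
(S_{l+1}, …, S_k), empty prefix included, and let B be its total, so that b ≤ 0 and b ≤ B. The left
side is the indicator of: Y_l + B = 0, Y_l ≥ -b, and Y_j ≤ Y_l for 1 ≤ j ≤ l.

The right side is summed from the inside out. The plates π are the quasi-shuffles of the later
blocks of T_1 with (S_{l+1}, …, S_k), behind the first block of T_1. Their alternating sum decouples
the two sequences, in that the two prefix minima are simply added (`sum_quasiShuffles`,
`sum_orientedPlates`). What remains of T_1 is that its nonempty prefix sums are at least -b and that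
its total is -B. If the carrier of T_1 is S_1 ∪ ⋯ ∪ S_i, then T_1 is a coarsening of (S_1, …, S_i),
and inclusion–exclusion over coarsenings yields the indicator that Y reaches the level -b for the
first time at i (`sum_coarsenings`). The other members form a chain composite of S_{i+1}, …, S_l;
their signed sum is the indicator that Y_l = Y_i and Y stays at or below Y_i in between
(`sum_chainComposites_prod_plateInd`, by the same argument with b = B = 0 and induction). The first
passage index is unique, so at most one i survives, and its conditions combine to those of the left
side (`sum_firstPassage`).

The sign (-1)^c is multiplicative over the members, because a member with r blocks has exactly r - 1
strict steps. Standardness holds because each carrier is a run of consecutive S_j whose positions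
increase weakly, so the lowest index lies in the first block, and π keeps the first block of T_1 as
its own. -/

/-- The indicator of a proposition, as a complex number. -/
noncomputable def ind (p : Prop) : ℂ := open Classical in if p then 1 else 0

theorem ind_of_true {p : Prop} (h : p) : ind p = 1 := by simp [ind, h]

theorem ind_of_not {p : Prop} (h : ¬p) : ind p = 0 := by simp [ind, h]

theorem ind_and (p q : Prop) : ind (p ∧ q) = ind p * ind q := by
  by_cases hp : p <;> by_cases hq : q <;> simp [ind, hp, hq]

theorem ind_congr {p q : Prop} (h : p ↔ q) : ind p = ind q := by rw [propext h]

/-! ### Lists of disjoint blocks and the order they induce -/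

namespace BlockList

variable {n : ℕ}

/-- The position of the first block containing `x`. -/
def position (L : List (Finset (Fin n))) (x : Fin n) : ℕ := L.findIdx (fun B => decide (x ∈ B))

/-- The union of the blocks. -/
def union (L : List (Finset (Fin n))) : Finset (Fin n) := L.toFinset.sup id

/-- The blocks are nonempty and pairwise disjoint. -/
def IsOrdered (L : List (Finset (Fin n))) : Prop :=
  (∀ B ∈ L, B.Nonempty) ∧ L.Pairwise Disjoint

@[simp] theorem union_nil : union ([] : List (Finset (Fin n))) = ∅ := rfl

@[simp] theorem union_cons (B : Finset (Fin n)) (L : List (Finset (Fin n))) :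
    union (B :: L) = B ∪ union L := by
  simp [union]

theorem mem_union {L : List (Finset (Fin n))} {x : Fin n} : x ∈ union L ↔ ∃ B ∈ L, x ∈ B := by
  induction L with
  | nil => simp
  | cons B L ih => simp [ih]

theorem position_cons_of_mem {B : Finset (Fin n)} {L : List (Finset (Fin n))} {x : Fin n}
    (h : x ∈ B) : position (B :: L) x = 0 := by
  simp [position, List.findIdx_cons, h]

theorem position_cons_of_notMem {B : Finset (Fin n)} {L : List (Finset (Fin n))} {x : Fin n}
    (h : x ∉ B) : position (B :: L) x = position L x + 1 := by
  simp [position, List.findIdx_cons, h]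

theorem position_cons_eq_zero {B : Finset (Fin n)} {L : List (Finset (Fin n))} {x : Fin n} :
    position (B :: L) x = 0 ↔ x ∈ B := by
  by_cases h : x ∈ B
  · simp [position_cons_of_mem h, h]
  · simp [position_cons_of_notMem h, h]

theorem isOrdered_cons {B : Finset (Fin n)} {L : List (Finset (Fin n))} :
    IsOrdered (B :: L) ↔ B.Nonempty ∧ Disjoint B (union L) ∧ IsOrdered L := by
  have : (∀ a' ∈ L, Disjoint B a') ↔ Disjoint B (union L) := by
    simp only [Finset.disjoint_left, mem_union]
    grind
  simp only [IsOrdered, List.mem_cons, forall_eq_or_imp, List.pairwise_cons, this]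
  tauto

theorem IsOrdered.eq_nil {L : List (Finset (Fin n))} (hL : IsOrdered L) (h : union L = ∅) :
    L = [] := by
  cases L with
  | nil => rfl
  | cons B L =>
    obtain ⟨x, hx⟩ := (isOrdered_cons.1 hL).1
    have : x ∈ union (B :: L) := by simp [hx]
    simp [h] at this

theorem position_lt_length {L : List (Finset (Fin n))} {x : Fin n} :
    position L x < L.length ↔ x ∈ union L := by
  simp [position, List.findIdx_lt_length, mem_union]

theorem IsOrdered.exists_position_eq {L : List (Finset (Fin n))} (hL : IsOrdered L) {q : ℕ}
    (hq : q < L.length) : ∃ x ∈ union L, position L x = q := by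
  induction L generalizing q with
  | nil => simp at hq
  | cons B L ih =>
    obtain ⟨⟨x, hx⟩, hd, hL'⟩ := isOrdered_cons.1 hL
    cases q with
    | zero => exact ⟨x, by simp [hx], position_cons_of_mem hx⟩
    | succ q =>
      obtain ⟨y, hy, hyq⟩ := ih hL' (by simpa using hq)
      exact ⟨y, by simp [hy], by
        rw [position_cons_of_notMem (Finset.disjoint_right.1 hd hy), hyq]⟩

/-- The block order determines the list of blocks. -/
theorem IsOrdered.ext {L L' : List (Finset (Fin n))} (hL : IsOrdered L) (hL' : IsOrdered L')
    (hu : union L = union L')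
    (h : ∀ x ∈ union L, ∀ y ∈ union L,
      (position L x < position L y ↔ position L' x < position L' y)) : L = L' := by
  induction L generalizing L' with
  | nil => exact (hL'.eq_nil hu.symm).symm
  | cons B L ih =>
    cases L' with
    | nil => exact hL.eq_nil hu
    | cons B' L' =>
      -- The first block is recovered from the order alone, as the set of labels with nothing
      -- strictly before them.
      have key : ∀ {C : Finset (Fin n)} {M : List (Finset (Fin n))}, IsOrdered (C :: M) →
          ∀ x ∈ union (C :: M), (x ∈ C ↔
            ∀ y ∈ union (C :: M), ¬ position (C :: M) y < position (C :: M) x) := by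
        intro C M hCM x _
        obtain ⟨⟨c, hc⟩, -⟩ := isOrdered_cons.1 hCM
        constructor
        · intro hxC y _
          simp [position_cons_of_mem hxC]
        · intro hx
          have := hx c (by simp [hc])
          rw [position_cons_of_mem hc, Nat.pos_iff_ne_zero, not_not] at this
          exact position_cons_eq_zero.1 this
      have hB : B = B' := by
        ext x
        by_cases hx : x ∈ union (B :: L)
        · rw [key hL x hx, key hL' x (hu ▸ hx), ← hu]
          exact forall₂_congr fun y hy => not_congr (h y hy x hx)
        · have hx' := hx
          rw [hu] at hx'
          simp only [union_cons, Finset.mem_union, not_or] at hx hx'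
          simp [hx.1, hx'.1]
      subst hB
      obtain ⟨-, hd, hLo⟩ := isOrdered_cons.1 hL
      obtain ⟨-, hd', hLo'⟩ := isOrdered_cons.1 hL'
      have hu' : union L = union L' := by
        ext x
        have h1 := Finset.ext_iff.1 hu x
        simp only [union_cons, Finset.mem_union] at h1
        have h2 : x ∈ B → x ∉ union L := fun h => Finset.disjoint_left.1 hd h
        have h3 : x ∈ B → x ∉ union L' := fun h => Finset.disjoint_left.1 hd' h
        tauto
      rw [ih hLo hLo' hu']
      intro x hx y hy
      have := h x (by simp [hx]) y (by simp [hy])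
      have hxB := Finset.disjoint_right.1 hd hx
      have hyB := Finset.disjoint_right.1 hd hy
      simpa [position_cons_of_notMem, hxB, hyB] using this

/-! ### Restriction of block lists and quasi-shuffles -/

/-- The nonempty intersections of the blocks with `A`. -/
def restrict (A : Finset (Fin n)) : List (Finset (Fin n)) → List (Finset (Fin n))
  | [] => []
  | B :: L => if (B ∩ A).Nonempty then (B ∩ A) :: restrict A L else restrict A L

theorem union_restrict (A : Finset (Fin n)) (L : List (Finset (Fin n))) :
    union (restrict A L) = union L ∩ A := by
  induction L with
  | nil => simp [restrict]
  | cons B L ih =>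
    rw [restrict]
    split_ifs with h
    · simp [ih, Finset.union_inter_distrib_right]
    · rw [ih, union_cons, Finset.union_inter_distrib_right, Finset.not_nonempty_iff_eq_empty.1 h,
        Finset.empty_union]

theorem IsOrdered.restrict {L : List (Finset (Fin n))} (hL : IsOrdered L) (A : Finset (Fin n)) :
    IsOrdered (restrict A L) := by
  induction L with
  | nil => exact hL
  | cons B L ih =>
    obtain ⟨-, hd, hLo⟩ := isOrdered_cons.1 hL
    rw [BlockList.restrict]
    split_ifs with h
    · refine isOrdered_cons.2 ⟨h, ?_, ih hLo⟩
      rw [union_restrict]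
      exact hd.mono Finset.inter_subset_left Finset.inter_subset_left
    · exact ih hLo

/-- A deleted block contains neither label, so its removal lowers both positions by one. Labels in
no block cause no exception: their position is the length of the list on either side. -/
theorem position_restrict_lt {A : Finset (Fin n)} {x y : Fin n} (hx : x ∈ A) (hy : y ∈ A)
    (L : List (Finset (Fin n))) :
    position (restrict A L) x < position (restrict A L) y ↔ position L x < position L y := by
  induction L with
  | nil => simp [restrict, position]
  | cons B L ih =>
    rw [restrict]
    split_ifs with h
    · by_cases hxB : x ∈ B <;> by_cases hyB : y ∈ B <;>
        simp [position_cons_of_mem, position_cons_of_notMem, hx, hy, hxB, hyB, ih]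
    · have hxB : x ∉ B := fun hB => h ⟨x, by simp [hB, hx]⟩
      have hyB : y ∉ B := fun hB => h ⟨y, by simp [hB, hy]⟩
      simp [position_cons_of_notMem, hxB, hyB, ih]

/-- The quasi-shuffles of two lists of blocks. -/
def quasiShuffles :
    List (Finset (Fin n)) → List (Finset (Fin n)) → Finset (List (Finset (Fin n)))
  | [], vs => {vs}
  | u :: us, [] => {u :: us}
  | u :: us, v :: vs =>
    (quasiShuffles us (v :: vs)).image (List.cons u) ∪
      ((quasiShuffles (u :: us) vs).image (List.cons v) ∪
        (quasiShuffles us vs).image (List.cons (u ∪ v)))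
  termination_by us vs => us.length + vs.length

@[simp] theorem quasiShuffles_nil_left (vs : List (Finset (Fin n))) :
    quasiShuffles [] vs = {vs} := by
  simp [quasiShuffles]

@[simp] theorem quasiShuffles_nil_right (us : List (Finset (Fin n))) :
    quasiShuffles us [] = {us} := by
  cases us <;> simp [quasiShuffles]

theorem quasiShuffles_cons_cons (u v : Finset (Fin n)) (us vs : List (Finset (Fin n))) :
    quasiShuffles (u :: us) (v :: vs) =
    (quasiShuffles us (v :: vs)).image (List.cons u) ∪
      ((quasiShuffles (u :: us) vs).image (List.cons v) ∪
        (quasiShuffles us vs).image (List.cons (u ∪ v))) := by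
  rw [quasiShuffles]

theorem restrict_eq_self {A : Finset (Fin n)} {L : List (Finset (Fin n))}
    (h : ∀ B ∈ L, B.Nonempty ∧ B ⊆ A) : restrict A L = L := by
  induction L with
  | nil => rfl
  | cons B L ih =>
    have hB := h B (by simp)
    rw [restrict, Finset.inter_eq_left.2 hB.2, if_pos hB.1,
      ih fun C hC => h C (by simp [hC])]

theorem restrict_eq_nil {A : Finset (Fin n)} {L : List (Finset (Fin n))}
    (h : ∀ B ∈ L, Disjoint B A) : restrict A L = [] := by
  induction L with
  | nil => rfl
  | cons B L ih =>
    rw [restrict, Finset.disjoint_iff_inter_eq_empty.1 (h B (by simp)), if_neg (by simp),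
      ih fun C hC => h C (by simp [hC])]

/-- Together with the converse `mem_quasiShuffles_restrict`, this identifies the quasi-shuffles as
the lists with prescribed restrictions to the two disjoint label sets. -/
theorem restrict_of_mem_quasiShuffles {A A' : Finset (Fin n)} (hA : Disjoint A A')
    {us vs L : List (Finset (Fin n))} (hus : ∀ B ∈ us, B.Nonempty ∧ B ⊆ A)
    (hvs : ∀ B ∈ vs, B.Nonempty ∧ B ⊆ A') (hL : L ∈ quasiShuffles us vs) :
    (∀ B ∈ L, B.Nonempty ∧ B ⊆ A ∪ A') ∧ restrict A L = us ∧ restrict A' L = vs := by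
  induction us, vs using quasiShuffles.induct generalizing L with
  | case1 vs =>
    simp only [quasiShuffles_nil_left, Finset.mem_singleton] at hL
    subst hL
    exact ⟨fun B hB => ⟨(hvs B hB).1, (hvs B hB).2.trans Finset.subset_union_right⟩,
      restrict_eq_nil fun B hB => hA.symm.mono_left (hvs B hB).2, restrict_eq_self hvs⟩
  | case2 u us =>
    simp only [quasiShuffles_nil_right, Finset.mem_singleton] at hL
    subst hL
    exact ⟨fun B hB => ⟨(hus B hB).1, (hus B hB).2.trans Finset.subset_union_left⟩,
      restrict_eq_self hus, restrict_eq_nil fun B hB => hA.mono_left (hus B hB).2⟩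
  | case3 u us v vs ih1 ih2 ih3 =>
    obtain ⟨hu, hus'⟩ := List.forall_mem_cons.1 hus
    obtain ⟨hv, hvs'⟩ := List.forall_mem_cons.1 hvs
    have huA : u ∩ A = u := Finset.inter_eq_left.2 hu.2
    have hvA : v ∩ A' = v := Finset.inter_eq_left.2 hv.2
    have huA' : u ∩ A' = ∅ := Finset.disjoint_iff_inter_eq_empty.1 (hA.mono_left hu.2)
    have hvA' : v ∩ A = ∅ := Finset.disjoint_iff_inter_eq_empty.1 (hA.symm.mono_left hv.2)
    rw [quasiShuffles_cons_cons] at hL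
    simp only [Finset.mem_union, Finset.mem_image] at hL
    rcases hL with ⟨M, hM, rfl⟩ | ⟨M, hM, rfl⟩ | ⟨M, hM, rfl⟩
    · obtain ⟨h1, h2, h3⟩ := ih1 hus' hvs hM
      refine ⟨List.forall_mem_cons.2 ⟨⟨hu.1, hu.2.trans Finset.subset_union_left⟩, h1⟩, ?_, ?_⟩
      · simp [restrict, huA, hu.1, h2]
      · simp [restrict, huA', h3]
    · obtain ⟨h1, h2, h3⟩ := ih2 hus hvs' hM
      refine ⟨List.forall_mem_cons.2 ⟨⟨hv.1, hv.2.trans Finset.subset_union_right⟩, h1⟩, ?_, ?_⟩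
      · simp [restrict, hvA', h2]
      · simp [restrict, hvA, hv.1, h3]
    · obtain ⟨h1, h2, h3⟩ := ih3 hus' hvs' hM
      refine ⟨List.forall_mem_cons.2 ⟨⟨hu.1.mono Finset.subset_union_left,
        Finset.union_subset_union hu.2 hv.2⟩, h1⟩, ?_, ?_⟩
      · simp [restrict, Finset.union_inter_distrib_right, huA, hvA', hu.1, h2]
      · simp [restrict, Finset.union_inter_distrib_right, huA', hvA, hv.1, h3]

/-- The head block meets A only, A' only, or both; these are the three ways in which a quasi-shuffle
can begin. -/
theorem mem_quasiShuffles_restrict {A A' : Finset (Fin n)} {L : List (Finset (Fin n))}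
    (hL : ∀ B ∈ L, B.Nonempty ∧ B ⊆ A ∪ A') :
    L ∈ quasiShuffles (restrict A L) (restrict A' L) := by
  induction L with
  | nil => simp [restrict]
  | cons B L ih =>
    obtain ⟨hB, hL'⟩ := List.forall_mem_cons.1 hL
    have ih := ih hL'
    have hBu : (B ∩ A) ∪ (B ∩ A') = B := by
      rw [← Finset.inter_union_distrib_left, Finset.inter_eq_left.2 hB.2]
    rw [restrict, restrict]
    by_cases h1 : (B ∩ A).Nonempty <;> by_cases h2 : (B ∩ A').Nonempty
    · rw [if_pos h1, if_pos h2, quasiShuffles_cons_cons]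
      simp [hBu, ih]
    · rw [if_pos h1, if_neg h2]
      rw [Finset.not_nonempty_iff_eq_empty.1 h2, Finset.union_empty] at hBu
      rw [hBu]
      cases h : restrict A' L with
      | nil => simpa [h] using ih
      | cons v vs =>
        rw [quasiShuffles_cons_cons]
        rw [h] at ih
        simp [ih]
    · rw [if_neg h1, if_pos h2]
      rw [Finset.not_nonempty_iff_eq_empty.1 h1, Finset.empty_union] at hBu
      rw [hBu]
      cases h : restrict A L with
      | nil => simpa [h] using ih
      | cons v vs =>
        rw [quasiShuffles_cons_cons]
        rw [h] at ih
        simp [ih]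
    · rw [Finset.not_nonempty_iff_eq_empty] at h1 h2
      rw [h1, h2, Finset.empty_union] at hBu
      exact absurd hB.1 (by simp [← hBu])

/-! ### Prefix minima and the alternating sum over quasi-shuffles -/

/-- The least sum of the coordinates of `x` over a union of initial blocks, the empty union
included. -/
noncomputable def minPrefix (x : Fin n → ℝ) : List (Finset (Fin n)) → ℝ
  | [] => 0
  | B :: L => min 0 (∑ i ∈ B, x i + minPrefix x L)

/-- The least sum of the coordinates of `x` over a nonempty union of initial blocks. -/
noncomputable def minPrefixPos (x : Fin n → ℝ) : List (Finset (Fin n)) → ℝ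
  | [] => 0
  | B :: L => ∑ i ∈ B, x i + minPrefix x L

theorem minPrefix_eq (x : Fin n → ℝ) (L : List (Finset (Fin n))) :
    minPrefix x L = min 0 (minPrefixPos x L) := by
  cases L <;> simp [minPrefix, minPrefixPos]

theorem minPrefix_nonpos (x : Fin n → ℝ) (L : List (Finset (Fin n))) : minPrefix x L ≤ 0 := by
  rw [minPrefix_eq]
  exact min_le_left _ _

theorem ind_min_nonneg (s p : ℝ) : ind (0 ≤ s + min 0 p) = ind (0 ≤ s) * ind (0 ≤ s + p) := by
  rw [← ind_and]
  refine ind_congr ?_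
  rcases min_cases 0 p with ⟨h, h'⟩ | ⟨h, h'⟩ <;> rw [h]
  · constructor
    · intro hs
      constructor <;> linarith
    · rintro ⟨hs, -⟩
      linarith
  · constructor
    · intro hs
      constructor <;> linarith
    · exact fun hs => hs.2

/-- One step of the quasi-shuffle recursion: the three terms on the left belong to the heads u, v
and u ∪ v. For s ≥ 0 the signs of p and q decide: both nonnegative gives 1 + 1 - 1, opposite signs
cancel one pair, and if both are nonpositive all terms agree. -/
theorem ind_quasiShuffle (s p q : ℝ) :
    ind (0 ≤ s) * (ind (0 ≤ s + p + min 0 q) + ind (0 ≤ s + q + min 0 p) - ind (0 ≤ s + p + q)) =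
      ind (0 ≤ s + min 0 p + min 0 q) := by
  by_cases hs : 0 ≤ s
  · rw [ind_of_true hs, one_mul]
    rcases le_total 0 p with hp | hp <;> rcases le_total 0 q with hq | hq
    · rw [min_eq_left hp, min_eq_left hq, ind_of_true, ind_of_true, ind_of_true, ind_of_true]
      · ring
      all_goals linarith
    · rw [min_eq_left hp, min_eq_right hq, add_zero, add_zero]
      ring
    · rw [min_eq_right hp, min_eq_left hq, add_zero, add_right_comm s q p]
      ring
    · rw [min_eq_right hp, min_eq_right hq, add_right_comm s q p]
      ring
  · have h1 := min_le_left 0 p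
    have h2 := min_le_left 0 q
    rw [ind_of_not hs, zero_mul, ind_of_not]
    linarith

/-- The shift s carries the sum over the blocks already placed and has to vary in the induction. A
merged head shortens the list by one, whence the minus sign in `ind_quasiShuffle`. -/
theorem sum_quasiShuffles (x : Fin n → ℝ) {us vs : List (Finset (Fin n))}
    (hus : ∀ B ∈ us, B.Nonempty) (hvs : ∀ B ∈ vs, B.Nonempty)
    (hd : Disjoint (union us) (union vs)) (s : ℝ) :
    ∑ L ∈ quasiShuffles us vs,
        (-1 : ℂ) ^ (us.length + vs.length + L.length) * ind (0 ≤ s + minPrefix x L) =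
      ind (0 ≤ s + minPrefix x us + minPrefix x vs) := by
  induction us, vs using quasiShuffles.induct generalizing s with
  | case1 vs =>
    simp [minPrefix, ← two_mul]
  | case2 u us =>
    have : minPrefix x [] = 0 := rfl
    rw [quasiShuffles_nil_right, Finset.sum_singleton, List.length_nil, add_zero, ← two_mul,
      pow_mul, neg_one_sq, one_pow, one_mul, this, add_zero]
  | case3 u us v vs ih1 ih2 ih3 =>
    obtain ⟨hu, hus'⟩ := List.forall_mem_cons.1 hus
    obtain ⟨hv, hvs'⟩ := List.forall_mem_cons.1 hvs
    have huv : Disjoint u v := hd.mono (by simp) (by simp)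
    have hd1 : Disjoint (union us) (union (v :: vs)) := hd.mono_left (by simp)
    have hd2 : Disjoint (union (u :: us)) (union vs) := hd.mono_right (by simp)
    have hd3 : Disjoint (union us) (union vs) := hd1.mono_right (by simp)
    -- The heads u, v and u ∪ v are pairwise distinct, so the three images in the recursion are
    -- disjoint and the sum splits.
    have hne1 : u ≠ v := by
      rintro rfl
      exact hu.ne_empty (Finset.disjoint_self_iff_empty _ |>.1 huv)
    have hne2 : u ≠ u ∪ v := by
      intro h
      have h' : v ⊆ u := Finset.union_eq_left.1 h.symm
      exact hv.ne_empty (Finset.disjoint_self_iff_empty _ |>.1 (huv.mono_left h'))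
    have hne3 : v ≠ u ∪ v := by
      intro h
      have h' : u ⊆ v := Finset.union_eq_right.1 h.symm
      exact hu.ne_empty (Finset.disjoint_self_iff_empty _ |>.1 (huv.mono_right h'))
    have hinj : ∀ (w : Finset (Fin n)) (X : Finset (List (Finset (Fin n)))),
        Set.InjOn (List.cons w) X := fun w X a _ b _ h => (List.cons.inj h).2
    have hdis : ∀ {w w' : Finset (Fin n)} (X Y : Finset (List (Finset (Fin n)))), w ≠ w' →
        Disjoint (X.image (List.cons w)) (Y.image (List.cons w')) := by
      intro w w' X Y hw
      rw [Finset.disjoint_left]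
      intro a ha ha'
      obtain ⟨b, -, rfl⟩ := Finset.mem_image.1 ha
      obtain ⟨c, -, hc⟩ := Finset.mem_image.1 ha'
      exact hw (List.cons.inj hc).1.symm
    rw [quasiShuffles_cons_cons, Finset.sum_union, Finset.sum_union,
      Finset.sum_image (hinj _ _), Finset.sum_image (hinj _ _), Finset.sum_image (hinj _ _)]
    rotate_left
    · exact hdis _ _ hne3
    · exact Finset.disjoint_union_right.2 ⟨hdis _ _ hne1, hdis _ _ hne2⟩
    have step : ∀ (w : Finset (Fin n)) (L : List (Finset (Fin n))),
        ind (0 ≤ s + minPrefix x (w :: L)) =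
          ind (0 ≤ s) * ind (0 ≤ (s + ∑ i ∈ w, x i) + minPrefix x L) := by
      intro w L
      rw [minPrefix, ind_min_nonneg, add_assoc]
    have e1 := ih1 hus' hvs hd1 (s + ∑ i ∈ u, x i)
    have e2 := ih2 hus hvs' hd2 (s + ∑ i ∈ v, x i)
    have e3 := ih3 hus' hvs' hd3 (s + ∑ i ∈ u ∪ v, x i)
    rw [Finset.sum_union huv] at e3
    -- Here p and q are the minima over the nonempty prefixes of the two lists; `min 0` adds the
    -- empty prefix.
    have key := ind_quasiShuffle s (∑ i ∈ u, x i + minPrefix x us) (∑ i ∈ v, x i + minPrefix x vs)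
    have g1 : s + (∑ i ∈ u, x i + minPrefix x us) + min 0 (∑ i ∈ v, x i + minPrefix x vs) =
      s + ∑ i ∈ u, x i + minPrefix x us + minPrefix x (v :: vs) := by
        rw [minPrefix, ← add_assoc]
    have g2 : s + (∑ i ∈ v, x i + minPrefix x vs) + min 0 (∑ i ∈ u, x i + minPrefix x us) =
      s + ∑ i ∈ v, x i + minPrefix x (u :: us) + minPrefix x vs := by
        rw [minPrefix]; ring
    have g3 : s + (∑ i ∈ u, x i + minPrefix x us) + (∑ i ∈ v, x i + minPrefix x vs) =
      s + (∑ i ∈ u, x i + ∑ i ∈ v, x i) + minPrefix x us + minPrefix x vs := by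
        ring
    rw [g1, g2, g3, ← e1, ← e2, ← e3] at key
    have g4 : s + minPrefix x (u :: us) + minPrefix x (v :: vs) =
      s + min 0 (∑ i ∈ u, x i + minPrefix x us) + min 0 (∑ i ∈ v, x i + minPrefix x vs) := rfl
    rw [g4, ← key, mul_sub, mul_add, Finset.mul_sum, Finset.mul_sum, Finset.mul_sum,
      add_sub_assoc, sub_eq_add_neg, ← Finset.sum_neg_distrib]
    refine congrArg₂ _ (Finset.sum_congr rfl fun L _ => ?_) (congrArg₂ _
      (Finset.sum_congr rfl fun L _ => ?_) (Finset.sum_congr rfl fun L _ => ?_)) <;>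
    · rw [step]
      try rw [Finset.sum_union huv]
      simp only [List.length_cons]
      ring

/-! ### Coarsenings and first passage -/

/-- The lists of blocks obtained from `s :: ts` by uniting runs of consecutive blocks. -/
def coarsenings : Finset (Fin n) → List (Finset (Fin n)) → Finset (List (Finset (Fin n)))
  | s, [] => {[s]}
  | s, t :: ts => coarsenings (s ∪ t) ts ∪ (coarsenings t ts).image (List.cons s)

/-- Each of the sets in the list `ss` lies in a block of `L`, and the positions of these blocks
increase weakly. -/
def IsMonotoneAlong (L ss : List (Finset (Fin n))) : Prop :=
  (∀ t ∈ ss, ∀ x ∈ t, ∀ y ∈ t, position L x ≤ position L y) ∧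
    ss.Pairwise fun s t => ∀ x ∈ s, ∀ y ∈ t, position L x ≤ position L y

theorem isMonotoneAlong_cons {L ss : List (Finset (Fin n))} {s : Finset (Fin n)} :
    IsMonotoneAlong L (s :: ss) ↔ (∀ x ∈ s, ∀ y ∈ s, position L x ≤ position L y) ∧
      (∀ x ∈ s, ∀ y ∈ union ss, position L x ≤ position L y) ∧ IsMonotoneAlong L ss := by
  have : (∀ t ∈ ss, ∀ x ∈ s, ∀ y ∈ t, position L x ≤ position L y) ↔
      ∀ x ∈ s, ∀ y ∈ union ss, position L x ≤ position L y := by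
    simp only [mem_union]
    grind
  simp only [IsMonotoneAlong, List.mem_cons, forall_eq_or_imp, List.pairwise_cons, this]
  tauto

theorem isMonotoneAlong_cons_left {B : Finset (Fin n)} {L ss : List (Finset (Fin n))}
    (h : Disjoint B (union ss)) : IsMonotoneAlong (B :: L) ss ↔ IsMonotoneAlong L ss := by
  induction ss with
  | nil => simp [IsMonotoneAlong]
  | cons s ss ih =>
    have hs : ∀ x ∈ s, position (B :: L) x = position L x + 1 := fun x hx =>
      position_cons_of_notMem (Finset.disjoint_right.1 h (by simp [hx]))
    have hss : ∀ x ∈ union ss, position (B :: L) x = position L x + 1 := fun x hx =>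
      position_cons_of_notMem (Finset.disjoint_right.1 h (by simp [hx]))
    rw [isMonotoneAlong_cons, isMonotoneAlong_cons, ih (h.mono_right (by simp))]
    refine and_congr (forall₂_congr fun x hx => forall₂_congr fun y hy => ?_)
      (and_congr (forall₂_congr fun x hx => forall₂_congr fun y hy => ?_) Iff.rfl)
    · rw [hs x hx, hs y hy, Nat.add_le_add_iff_right]
    · rw [hs x hx, hss y hy, Nat.add_le_add_iff_right]

/-- Monotonicity forces s into the first block B of L. Either B also meets t, and then contains it,
so that L coarsens the list with s and t united; or B = s, and the tail of L coarsens the rest. -/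
theorem IsOrdered.mem_coarsenings {s : Finset (Fin n)} {ts L : List (Finset (Fin n))}
    (hts : IsOrdered (s :: ts)) :
    L ∈ coarsenings s ts ↔
      IsOrdered L ∧ union L = union (s :: ts) ∧ IsMonotoneAlong L (s :: ts) := by
  induction ts generalizing s L with
  | nil =>
    obtain ⟨⟨a, ha⟩, -⟩ := isOrdered_cons.1 hts
    simp only [coarsenings, Finset.mem_singleton]
    refine ⟨?_, ?_⟩
    · intro h
      subst h
      refine ⟨hts, rfl, fun t ht x hx y _ => ?_, List.pairwise_singleton _ _⟩
      rw [List.mem_singleton] at ht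
      subst ht
      simp [position_cons_of_mem hx]
    · rintro ⟨hL, hu, hm⟩
      cases L with
      | nil =>
        have : a ∈ union [s] := by simp [ha]
        simp [← hu] at this
      | cons B L =>
        obtain ⟨⟨b, hb⟩, hd, hLo⟩ := isOrdered_cons.1 hL
        have hbs : b ∈ s := by
          have : b ∈ union (B :: L) := by simp [hb]
          simpa [hu] using this
        have hsB : s ⊆ B := by
          intro x hx
          have := hm.1 s (by simp) x hx b hbs
          rw [position_cons_of_mem hb, Nat.le_zero] at this
          exact position_cons_eq_zero.1 this
        have hLu : union L = ∅ := by
          rw [Finset.eq_empty_iff_forall_notMem]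
          intro y hy
          have h : y ∈ union (B :: L) := by simp [hy]
          have : y ∈ s := by simpa [hu] using h
          exact Finset.disjoint_right.1 hd hy (hsB this)
        rw [hLo.eq_nil hLu] at hu ⊢
        simpa using hu
  | cons t ts ih =>
    obtain ⟨⟨a, ha⟩, hds, htts⟩ := isOrdered_cons.1 hts
    obtain ⟨⟨c, hc⟩, hdt, hto⟩ := isOrdered_cons.1 htts
    have hst : IsOrdered ((s ∪ t) :: ts) := by
      refine isOrdered_cons.2 ⟨⟨a, by simp [ha]⟩, ?_, hto⟩
      exact Finset.disjoint_union_left.2 ⟨hds.mono_right (by simp), hdt⟩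
    rw [coarsenings, Finset.mem_union, Finset.mem_image, ih hst]
    constructor
    · rintro (⟨hL, hu, hm⟩ | ⟨M, hM, rfl⟩)
      · refine ⟨hL, by simpa using hu, ?_⟩
        simp only [isMonotoneAlong_cons, union_cons, Finset.mem_union] at hm ⊢
        grind
      · obtain ⟨hMo, hu, hm⟩ := (ih htts).1 hM
        refine ⟨isOrdered_cons.2 ⟨⟨a, ha⟩, hu ▸ hds, hMo⟩, by simp [hu], ?_⟩
        refine isMonotoneAlong_cons.2 ⟨?_, ?_, (isMonotoneAlong_cons_left hds).2 hm⟩ <;>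
        · intro x hx y _
          simp [position_cons_of_mem hx]
    · rintro ⟨hL, hu, hm⟩
      obtain ⟨hm1, hm2, hm3⟩ := isMonotoneAlong_cons.1 hm
      obtain ⟨hm4, hm5, hm6⟩ := isMonotoneAlong_cons.1 hm3
      cases L with
      | nil =>
        have : a ∈ union (s :: t :: ts) := by simp [ha]
        simp [← hu] at this
      | cons B L =>
        obtain ⟨⟨b, hb⟩, hd, hLo⟩ := isOrdered_cons.1 hL
        have hB0 : ∀ {x y}, position (B :: L) x ≤ position (B :: L) y → y ∈ B → x ∈ B := by
          intro x y hxy hy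
          rw [position_cons_of_mem hy, Nat.le_zero] at hxy
          exact position_cons_eq_zero.1 hxy
        have hbu : b ∈ s ∪ union (t :: ts) := by
          rw [← union_cons, ← hu]; simp [hb]
        have hsB : s ⊆ B := by
          intro x hx
          rcases Finset.mem_union.1 hbu with h | h
          · exact hB0 (hm1 x hx b h) hb
          · exact hB0 (hm2 x hx b h) hb
        by_cases ht : ∃ y ∈ t, y ∈ B
        · left
          obtain ⟨y, hyt, hyB⟩ := ht
          refine ⟨hL, by simpa using hu, ?_⟩
          have htB : ∀ x ∈ s ∪ t, position (B :: L) x = 0 := by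
            intro x hx
            rcases Finset.mem_union.1 hx with h | h
            · exact position_cons_of_mem (hsB h)
            · exact position_cons_of_mem (hB0 (hm4 x h y hyt) hyB)
          refine isMonotoneAlong_cons.2 ⟨?_, ?_, hm6⟩ <;>
          · intro x hx z _
            simp [htB x hx]
        · right
          push Not at ht
          have hBs : B = s := by
            refine Finset.Subset.antisymm (fun x hx => ?_) hsB
            have : x ∈ s ∪ (t ∪ union ts) := by
              rw [← union_cons, ← union_cons, ← hu]; simp [hx]
            rcases Finset.mem_union.1 this with h | h
            · exact h
            -- A label of a later set inside B would pull t into B as well.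
            · rcases Finset.mem_union.1 h with h | h
              · exact absurd hx (ht x h)
              · exact absurd (hB0 (hm5 c hc x h) hx) (ht c hc)
          subst hBs
          refine ⟨L, (ih htts).2 ⟨hLo, ?_, (isMonotoneAlong_cons_left hds).1 hm3⟩, rfl⟩
          ext x
          have h1 := Finset.ext_iff.1 hu x
          rw [union_cons, union_cons, Finset.mem_union, Finset.mem_union] at h1
          have h2 : x ∈ B → x ∉ union L := fun h => Finset.disjoint_left.1 hd h
          have h3 : x ∈ B → x ∉ union (t :: ts) := fun h => Finset.disjoint_left.1 hds h
          tauto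

theorem exists_cons_of_mem_coarsenings {s : Finset (Fin n)} {ts L : List (Finset (Fin n))}
    (h : L ∈ coarsenings s ts) : ∃ C M, L = C :: M ∧ s ⊆ C := by
  induction ts generalizing s L with
  | nil =>
    rw [coarsenings, Finset.mem_singleton] at h
    exact ⟨s, [], h, subset_rfl⟩
  | cons t ts ih =>
    rw [coarsenings, Finset.mem_union, Finset.mem_image] at h
    rcases h with h | ⟨M, -, rfl⟩
    · obtain ⟨C, M, rfl, hC⟩ := ih h
      exact ⟨C, M, rfl, Finset.subset_union_left.trans hC⟩
    · exact ⟨s, M, rfl, subset_rfl⟩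

/-- The sum of the coordinates of `x` over all the blocks of `s :: ts`, increased by `b`, is
nonnegative, but those over the proper initial segments of this list are negative. -/
def FirstNonneg (x : Fin n → ℝ) : ℝ → Finset (Fin n) → List (Finset (Fin n)) → Prop
  | b, s, [] => 0 ≤ b + ∑ i ∈ s, x i
  | b, s, t :: ts => b + ∑ i ∈ s, x i < 0 ∧ FirstNonneg x (b + ∑ i ∈ s, x i) t ts

theorem firstNonneg_union (x : Fin n → ℝ) (b : ℝ) {s t : Finset (Fin n)} (h : Disjoint s t)
    (ts : List (Finset (Fin n))) :
    FirstNonneg x b (s ∪ t) ts ↔ FirstNonneg x (b + ∑ i ∈ s, x i) t ts := by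
  cases ts <;> simp [FirstNonneg, Finset.sum_union h, add_assoc]

/-- Inclusion–exclusion at the boundary between s and t. Coarsenings that unite s and t impose
nothing there; those that cut there carry the opposite sign and the extra factor for a nonnegative
sum up to s. The difference leaves the factor for a negative sum. -/
theorem sum_coarsenings (x : Fin n → ℝ) (b : ℝ) {s : Finset (Fin n)}
    {ts : List (Finset (Fin n))} (hts : IsOrdered (s :: ts)) :
    ∑ L ∈ coarsenings s ts, (-1 : ℂ) ^ (L.length + 1) * ind (0 ≤ b + minPrefixPos x L) =
      ind (FirstNonneg x b s ts) := by
  induction ts generalizing s b with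
  | nil => simp [coarsenings, minPrefixPos, minPrefix, FirstNonneg]
  | cons t ts ih =>
    obtain ⟨⟨a, ha⟩, hds, htts⟩ := isOrdered_cons.1 hts
    obtain ⟨⟨c, hc⟩, hdt, hto⟩ := isOrdered_cons.1 htts
    have hst : IsOrdered ((s ∪ t) :: ts) := by
      refine isOrdered_cons.2 ⟨⟨a, by simp [ha]⟩, ?_, hto⟩
      exact Finset.disjoint_union_left.2 ⟨hds.mono_right (by simp), hdt⟩
    have hd : Disjoint s t := hds.mono_right (by simp)
    have hdis : Disjoint (coarsenings (s ∪ t) ts) ((coarsenings t ts).image (List.cons s)) := by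
      rw [Finset.disjoint_left]
      intro L hL hL'
      obtain ⟨C, M, rfl, hC⟩ := exists_cons_of_mem_coarsenings hL
      obtain ⟨M', -, hM'⟩ := Finset.mem_image.1 hL'
      rw [← (List.cons.inj hM').1] at hC
      exact Finset.disjoint_right.1 hd hc (hC (by simp [hc]))
    rw [coarsenings, Finset.sum_union hdis, Finset.sum_image (fun a _ b _ h => (List.cons.inj h).2),
      ih b hst, ind_congr (firstNonneg_union x b hd ts), FirstNonneg, ind_and]
    have hneg : ind (b + ∑ i ∈ s, x i < 0) = 1 - ind (0 ≤ b + ∑ i ∈ s, x i) := by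
      by_cases h : 0 ≤ b + ∑ i ∈ s, x i
      · rw [ind_of_true h, ind_of_not (not_lt.2 h), sub_self]
      · rw [ind_of_not h, ind_of_true (not_le.1 h), sub_zero]
    have hrec := ih (b + ∑ i ∈ s, x i) htts
    rw [hneg, sub_mul, one_mul, sub_eq_add_neg, ← hrec, Finset.mul_sum, ← Finset.sum_neg_distrib]
    refine congrArg _ (Finset.sum_congr rfl fun L _ => ?_)
    rw [minPrefixPos, minPrefix_eq, ← add_assoc, ind_min_nonneg, List.length_cons]
    ring

end BlockList

namespace OSP

variable {n : ℕ}

theorem isOrdered (T : OSP n) : BlockList.IsOrdered T.blocks := ⟨T.nonempty_of_mem, T.disjoint⟩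

theorem carrier_eq_union (T : OSP n) : T.carrier = BlockList.union T.blocks := rfl

theorem pos_eq_position (T : OSP n) (x : Fin n) : T.pos x = BlockList.position T.blocks x := rfl

theorem carrier_nonempty (T : OSP n) : T.carrier.Nonempty := by
  rw [Finset.nonempty_iff_ne_empty]
  exact fun h => T.ne_nil (T.isOrdered.eq_nil h)

theorem eq_of_disjoint_carrier {𝒯 : Finset (OSP n)}
    (h : ∀ T ∈ 𝒯, ∀ T' ∈ 𝒯, T ≠ T' → Disjoint T.carrier T'.carrier) {T T' : OSP n} (hT : T ∈ 𝒯)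
    (hT' : T' ∈ 𝒯) {x : Fin n} (hx : x ∈ T.carrier) (hx' : x ∈ T'.carrier) : T = T' := by
  by_contra hne
  exact Finset.disjoint_left.1 (h T hT T' hT' hne) hx hx'

end OSP

/-! ### Composite set partitions satisfying the chain of orientations -/

section Chain

variable {n : ℕ}

theorem isComposite_iff {𝒯 : Finset (OSP n)} {J : Finset (Fin n)} :
    IsComposite 𝒯 J ↔ (∀ T ∈ 𝒯, ∀ T' ∈ 𝒯, T ≠ T' → Disjoint T.carrier T'.carrier) ∧
      ∀ x, x ∈ J ↔ ∃ T ∈ 𝒯, x ∈ T.carrier := by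
  rw [IsComposite, Finset.ext_iff]
  simp only [Finset.mem_sup]
  exact and_congr Iff.rfl (forall_congr' fun x => Iff.comm)

/-- The sets `S₁, …, S_l` are nonempty and pairwise disjoint. -/
def IsDisjointFamily (S : ℕ → Finset (Fin n)) (l : ℕ) : Prop :=
  (∀ a ∈ Finset.Icc 1 l, (S a).Nonempty) ∧
    ∀ a ∈ Finset.Icc 1 l, ∀ b ∈ Finset.Icc 1 l, a ≠ b → Disjoint (S a) (S b)

theorem IsDisjointFamily.mono {S : ℕ → Finset (Fin n)} {l k : ℕ} (hS : IsDisjointFamily S k)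
    (h : l ≤ k) : IsDisjointFamily S l :=
  ⟨fun a ha => hS.1 a (Finset.Icc_subset_Icc_right h ha), fun a ha b hb =>
    hS.2 a (Finset.Icc_subset_Icc_right h ha) b (Finset.Icc_subset_Icc_right h hb)⟩

theorem IsDisjointFamily.shift {S : ℕ → Finset (Fin n)} {l : ℕ} (hS : IsDisjointFamily S l)
    (i : ℕ) : IsDisjointFamily (fun j => S (i + j)) (l - i) := by
  constructor
  · intro a ha
    rw [Finset.mem_Icc] at ha
    exact hS.1 _ (Finset.mem_Icc.2 (by omega))
  · intro a ha b hb hab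
    rw [Finset.mem_Icc] at ha hb
    exact hS.2 _ (Finset.mem_Icc.2 (by omega)) _ (Finset.mem_Icc.2 (by omega)) (by omega)

theorem IsDisjointFamily.eq_of_mem {S : ℕ → Finset (Fin n)} {l : ℕ} (hS : IsDisjointFamily S l)
    {a b : ℕ} (ha : a ∈ Finset.Icc 1 l) (hb : b ∈ Finset.Icc 1 l) {x : Fin n} (hxa : x ∈ S a)
    (hxb : x ∈ S b) : a = b := by
  by_contra h
  exact Finset.disjoint_left.1 (hS.2 a ha b hb h) hxa hxb

theorem IsDisjointFamily.subset_biUnion_iff {S : ℕ → Finset (Fin n)} {l : ℕ}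
    (hS : IsDisjointFamily S l) {I : Finset ℕ} (hI : I ⊆ Finset.Icc 1 l) {j : ℕ}
    (hj : j ∈ Finset.Icc 1 l) : S j ⊆ I.biUnion S ↔ j ∈ I := by
  constructor
  · intro h
    obtain ⟨x, hx⟩ := hS.1 j hj
    obtain ⟨a, ha, hxa⟩ := Finset.mem_biUnion.1 (h hx)
    rwa [hS.eq_of_mem hj (hI ha) hx hxa]
  · exact fun h => Finset.subset_biUnion_of_mem S h

/-- The condition that a member of a composite set partition satisfying the chain of orientations
`p_(S_l) ≥ ⋯ ≥ p_(S₁)` has to fulfil. -/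
structure IsAdapted (S : ℕ → Finset (Fin n)) (l : ℕ) (T : OSP n) : Prop where
  subset : ∀ a ∈ Finset.Icc 1 l, ∀ x ∈ S a, x ∈ T.carrier → S a ⊆ T.carrier
  pos_le : ∀ a b : ℕ, 1 ≤ a → a ≤ b → b ≤ l → S a ⊆ T.carrier → S b ⊆ T.carrier →
    ∀ x ∈ S a, ∀ y ∈ S b, T.pos x ≤ T.pos y
  convex : ∀ a b c : ℕ, 1 ≤ a → a ≤ b → b ≤ c → c ≤ l →
    S a ⊆ T.carrier → S c ⊆ T.carrier → S b ⊆ T.carrier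

/-- Turns the relations between consecutive sets into a condition on each member separately, so that
members can be removed or added independently. -/
theorem mem_chainComposites {S : ℕ → Finset (Fin n)} {l : ℕ} (hS : IsDisjointFamily S l)
    {𝒯 : Finset (OSP n)} :
    𝒯 ∈ chainComposites S l ↔
      IsComposite 𝒯 ((Finset.Icc 1 l).biUnion S) ∧ ∀ T ∈ 𝒯, IsAdapted S l T := by
  simp only [chainComposites, Finset.mem_filter, Finset.mem_univ, true_and]
  refine and_congr_right fun hc => ?_
  obtain ⟨hd, hmem⟩ := isComposite_iff.1 hc
  constructor
  · rintro ⟨h1, h2, h3⟩ T hT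
    have hsub : ∀ a ∈ Finset.Icc 1 l, ∀ x ∈ S a, x ∈ T.carrier → S a ⊆ T.carrier := by
      intro a ha x hx hxT y hy
      obtain ⟨T', hT', hxT', hyT', -⟩ := h1 a ha x hx y hy
      rwa [OSP.eq_of_disjoint_carrier hd hT hT' hxT hxT']
    have hsame : ∀ a ∈ Finset.Icc 1 l, S a ⊆ T.carrier → ∀ x ∈ S a, ∀ y ∈ S a,
        T.pos x = T.pos y := by
      intro a ha haT x hx y hy
      obtain ⟨T', hT', hxT', -, h⟩ := h1 a ha x hx y hy
      rwa [OSP.eq_of_disjoint_carrier hd hT hT' (haT hx) hxT']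
    refine ⟨hsub, ?_, fun a b c ha hab hbc hcl => h3 a b c ha hab hbc hcl T hT⟩
    intro a b ha hab
    induction b, hab using Nat.le_induction with
    | base =>
      intro hal haT _ x hx y hy
      exact (hsame a (Finset.mem_Icc.2 ⟨ha, hal⟩) haT x hx y hy).le
    | succ b hab ih =>
      intro hbl haT hbT x hx y hy
      -- Convexity keeps the intermediate set in T, so the consecutive relations compose inside T;
      -- the case of different members contradicts disjointness of the carriers.
      have hbT' := h3 a b (b + 1) ha hab (Nat.le_succ b) hbl T hT haT hbT
      obtain ⟨z, hz⟩ := hS.1 b (Finset.mem_Icc.2 (by omega))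
      refine (ih (by omega) haT hbT' x hx z hz).trans ?_
      rcases h2 b (Finset.mem_Ico.2 (by omega)) with h | h
      · rcases h z hz y hy with ⟨T', hT', hzT', -, hlt⟩ | ⟨T', hT', T'', hT'', hne, hzT', hyT''⟩
        · rw [OSP.eq_of_disjoint_carrier hd hT hT' (hbT' hz) hzT']
          exact hlt.le
        · refine absurd ?_ hne
          rw [← OSP.eq_of_disjoint_carrier hd hT hT' (hbT' hz) hzT',
            ← OSP.eq_of_disjoint_carrier hd hT hT'' (hbT hy) hyT'']
      · obtain ⟨T', hT', hzT', -, heq⟩ := h z hz y hy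
        rw [OSP.eq_of_disjoint_carrier hd hT hT' (hbT' hz) hzT']
        exact heq.le
  · intro h
    have hex : ∀ a ∈ Finset.Icc 1 l, ∃ T ∈ 𝒯, S a ⊆ T.carrier := by
      intro a ha
      obtain ⟨x, hx⟩ := hS.1 a ha
      obtain ⟨T, hT, hxT⟩ := (hmem x).1 (Finset.mem_biUnion.2 ⟨a, ha, hx⟩)
      exact ⟨T, hT, (h T hT).subset a ha x hx hxT⟩
    have hsame : ∀ a ∈ Finset.Icc 1 l, ∀ T ∈ 𝒯, S a ⊆ T.carrier → ∀ x ∈ S a, ∀ y ∈ S a,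
        T.pos x = T.pos y := by
      intro a ha T hT haT x hx y hy
      rw [Finset.mem_Icc] at ha
      exact le_antisymm ((h T hT).pos_le a a ha.1 le_rfl ha.2 haT haT x hx y hy)
        ((h T hT).pos_le a a ha.1 le_rfl ha.2 haT haT y hy x hx)
    refine ⟨?_, ?_, fun a b c ha hab hbc hcl T hT => (h T hT).convex a b c ha hab hbc hcl⟩
    · intro a ha x hx y hy
      obtain ⟨T, hT, haT⟩ := hex a ha
      exact ⟨T, hT, haT hx, haT hy, hsame a ha T hT haT x hx y hy⟩
    · intro a ha
      rw [Finset.mem_Ico] at ha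
      have ha1 : a ∈ Finset.Icc 1 l := Finset.mem_Icc.2 (by omega)
      have ha2 : a + 1 ∈ Finset.Icc 1 l := Finset.mem_Icc.2 (by omega)
      obtain ⟨T, hT, haT⟩ := hex a ha1
      obtain ⟨T', hT', haT'⟩ := hex (a + 1) ha2
      by_cases hTT : T = T'
      · subst hTT
        obtain ⟨u, hu⟩ := hS.1 a ha1
        obtain ⟨v, hv⟩ := hS.1 (a + 1) ha2
        have hle := (h T hT).pos_le a (a + 1) ha.1 (Nat.le_succ a) (by omega) haT haT' u hu v hv
        rcases hle.lt_or_eq with hlt | heq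
        · left
          intro x hx y hy
          refine Or.inl ⟨T, hT, haT hx, haT' hy, ?_⟩
          rwa [hsame a ha1 T hT haT x hx u hu, hsame (a + 1) ha2 T hT haT' y hy v hv]
        · right
          intro x hx y hy
          refine ⟨T, hT, haT hx, haT' hy, ?_⟩
          rwa [hsame a ha1 T hT haT x hx u hu, hsame (a + 1) ha2 T hT haT' y hy v hv]
      · left
        intro x hx y hy
        exact Or.inr ⟨T, hT, T', hT', hTT, haT hx, haT' hy⟩

theorem IsAdapted.exists_carrier_eq {S : ℕ → Finset (Fin n)} {l : ℕ} {T : OSP n}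
    (hT : IsAdapted S l T) (hsub : T.carrier ⊆ (Finset.Icc 1 l).biUnion S) :
    ∃ a b, 1 ≤ a ∧ a ≤ b ∧ b ≤ l ∧ T.carrier = (Finset.Icc a b).biUnion S := by
  set I := (Finset.Icc 1 l).filter (fun i => S i ⊆ T.carrier) with hI
  have hmem : ∀ x ∈ T.carrier, ∃ i ∈ I, x ∈ S i := by
    intro x hx
    obtain ⟨i, hi, hxi⟩ := Finset.mem_biUnion.1 (hsub hx)
    exact ⟨i, Finset.mem_filter.2 ⟨hi, hT.subset i hi x hxi hx⟩, hxi⟩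
  have hne : I.Nonempty := by
    obtain ⟨x, hx⟩ := T.carrier_nonempty
    obtain ⟨i, hi, -⟩ := hmem x hx
    exact ⟨i, hi⟩
  obtain ⟨ha, haT⟩ := Finset.mem_filter.1 (I.min'_mem hne)
  obtain ⟨hb, hbT⟩ := Finset.mem_filter.1 (I.max'_mem hne)
  rw [Finset.mem_Icc] at ha hb
  refine ⟨I.min' hne, I.max' hne, ha.1, I.min'_le _ (I.max'_mem hne), hb.2, ?_⟩
  refine Finset.Subset.antisymm (fun x hx => ?_) ?_
  · obtain ⟨i, hi, hxi⟩ := hmem x hx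
    exact Finset.mem_biUnion.2 ⟨i, Finset.mem_Icc.2 ⟨I.min'_le _ hi, I.le_max' _ hi⟩, hxi⟩
  · refine Finset.biUnion_subset.2 fun i hi => ?_
    rw [Finset.mem_Icc] at hi
    exact hT.convex _ i _ ha.1 hi.1 hi.2 hb.2 haT hbT

/-- A weakly increasing sequence takes a new value exactly at its strict steps. -/
theorem card_filter_lt_succ_add_one (p : ℕ → ℕ) {a b : ℕ} (hab : a ≤ b)
    (hp : ∀ i j, a ≤ i → i ≤ j → j ≤ b → p i ≤ p j) :
    ((Finset.Ico a b).filter (fun i => p i < p (i + 1))).card + 1 =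
      ((Finset.Icc a b).image p).card := by
  induction b, hab using Nat.le_induction with
  | base => simp
  | succ b hab ih =>
    have ih := ih fun i j hi hij hj => hp i j hi hij (by omega)
    have hle := hp b (b + 1) hab (Nat.le_succ b) le_rfl
    rw [← Finset.insert_Icc_right_eq_Icc_add_one (by omega), Finset.image_insert,
      ← Finset.insert_Ico_right_eq_Ico_add_one hab, Finset.filter_insert]
    by_cases h : p b < p (b + 1)
    · rw [if_pos h, Finset.card_insert_of_notMem (by simp), Finset.card_insert_of_notMem, ih]
      intro hmem
      obtain ⟨i, hi, hpi⟩ := Finset.mem_image.1 hmem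
      rw [Finset.mem_Icc] at hi
      have := hp i b hi.1 hi.2 (Nat.le_succ b)
      omega
    · rw [if_neg h, Finset.insert_eq_of_mem, ih]
      exact Finset.mem_image.2 ⟨b, Finset.mem_Icc.2 ⟨hab, le_rfl⟩, by omega⟩

-- Applied to the positions of the sets in the run forming the carrier: blocks are nonempty, so
-- every position from 0 to `T.len` - 1 is attained.
open Classical in
theorem IsAdapted.card_strict_add_one {S : ℕ → Finset (Fin n)} {l : ℕ}
    (hS : IsDisjointFamily S l) {T : OSP n} (hT : IsAdapted S l T)
    (hsub : T.carrier ⊆ (Finset.Icc 1 l).biUnion S) :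
    ((Finset.Ico 1 l).filter (fun i =>
      S i ⊆ T.carrier ∧ S (i + 1) ⊆ T.carrier ∧ T.BlockLT (S i) (S (i + 1)))).card + 1 =
      T.len := by
  obtain ⟨a, b, ha, hab, hbl, hcar⟩ := hT.exists_carrier_eq hsub
  have hsubI : Finset.Icc a b ⊆ Finset.Icc 1 l := Finset.Icc_subset_Icc ha hbl
  have hiff : ∀ j ∈ Finset.Icc 1 l, (S j ⊆ T.carrier ↔ a ≤ j ∧ j ≤ b) := fun j hj => by
    rw [hcar, hS.subset_biUnion_iff hsubI hj, Finset.mem_Icc]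
  -- One label represents each S_j; outside the index range any label of the carrier serves as a
  -- dummy.
  have hrep : ∀ j, ∃ x, j ∈ Finset.Icc 1 l → x ∈ S j := by
    intro j
    obtain ⟨z, -⟩ := T.carrier_nonempty
    by_cases hj : j ∈ Finset.Icc 1 l
    · obtain ⟨x, hx⟩ := hS.1 j hj
      exact ⟨x, fun _ => hx⟩
    · exact ⟨z, fun h => absurd h hj⟩
  choose f hf using hrep
  have hle : ∀ i j, a ≤ i → i ≤ j → j ≤ b → ∀ x ∈ S i, ∀ y ∈ S j, T.pos x ≤ T.pos y := by
    intro i j hi hij hj x hx y hy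
    exact hT.pos_le i j (by omega) hij (by omega)
      ((hiff i (Finset.mem_Icc.2 (by omega))).2 (by omega))
      ((hiff j (Finset.mem_Icc.2 (by omega))).2 (by omega)) x hx y hy
  have hmemf : ∀ i, a ≤ i → i ≤ b → f i ∈ S i := fun i hi hib =>
    hf i (Finset.mem_Icc.2 (by omega))
  have hcard := card_filter_lt_succ_add_one (fun j => T.pos (f j)) hab
    fun i j hi hij hj => hle i j hi hij hj _ (hmemf i hi (by omega)) _ (hmemf j (by omega) hj)
  have himage : (Finset.Icc a b).image (fun j => T.pos (f j)) = Finset.range T.len := by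
    ext q
    rw [Finset.mem_image, Finset.mem_range]
    constructor
    · rintro ⟨j, hj, rfl⟩
      have : f j ∈ T.carrier := by
        rw [hcar]
        rw [Finset.mem_Icc] at hj
        exact Finset.mem_biUnion.2 ⟨j, Finset.mem_Icc.2 hj, hmemf j hj.1 hj.2⟩
      exact BlockList.position_lt_length.2 this
    · intro hq
      obtain ⟨x, hx, hxq⟩ := T.isOrdered.exists_position_eq hq
      rw [← T.carrier_eq_union, hcar] at hx
      obtain ⟨j, hj, hxj⟩ := Finset.mem_biUnion.1 hx
      rw [Finset.mem_Icc] at hj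
      refine ⟨j, Finset.mem_Icc.2 hj, ?_⟩
      rw [← hxq]
      exact le_antisymm (hle j j hj.1 le_rfl hj.2 _ (hmemf j hj.1 hj.2) _ hxj)
        (hle j j hj.1 le_rfl hj.2 _ hxj _ (hmemf j hj.1 hj.2))
  rw [himage, Finset.card_range] at hcard
  rw [← hcard]
  congr 2
  ext i
  simp only [Finset.mem_filter, Finset.mem_Ico]
  constructor
  · rintro ⟨hi, hi1, hi2, hlt⟩
    have h1 := (hiff i (Finset.mem_Icc.2 (by omega))).1 hi1
    have h2 := (hiff (i + 1) (Finset.mem_Icc.2 (by omega))).1 hi2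
    exact ⟨by omega, hlt _ (hmemf i h1.1 h1.2) _ (hmemf _ h2.1 h2.2)⟩
  · rintro ⟨hi, hlt⟩
    refine ⟨by omega, (hiff i (Finset.mem_Icc.2 (by omega))).2 (by omega),
      (hiff (i + 1) (Finset.mem_Icc.2 (by omega))).2 (by omega), fun x hx y hy => ?_⟩
    have h1 := hle i i (by omega) le_rfl (by omega) x hx _ (hmemf i (by omega) (by omega))
    have h2 := hle (i + 1) (i + 1) (by omega) le_rfl (by omega) _
      (hmemf (i + 1) (by omega) (by omega)) y hy
    omega

/-- A strict step belongs to exactly one member, so c is the sum of the numbers `T.len` - 1; the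
exponent `T.len` + 1 has the same parity. -/
theorem neg_one_pow_strictCount {S : ℕ → Finset (Fin n)} {l : ℕ} (hS : IsDisjointFamily S l)
    {𝒯 : Finset (OSP n)} (h𝒯 : 𝒯 ∈ chainComposites S l) :
    (-1 : ℂ) ^ strictCount S l 𝒯 = ∏ T ∈ 𝒯, (-1 : ℂ) ^ (T.len + 1) := by
  classical
  obtain ⟨hc, had⟩ := (mem_chainComposites hS).1 h𝒯
  obtain ⟨hd, hmem⟩ := isComposite_iff.1 hc
  have hsub : ∀ T ∈ 𝒯, T.carrier ⊆ (Finset.Icc 1 l).biUnion S :=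
    fun T hT x hx => (hmem x).2 ⟨T, hT, hx⟩
  have hcount : strictCount S l 𝒯 = ∑ T ∈ 𝒯, ((Finset.Ico 1 l).filter (fun i =>
      S i ⊆ T.carrier ∧ S (i + 1) ⊆ T.carrier ∧ T.BlockLT (S i) (S (i + 1)))).card := by
    rw [← Finset.card_biUnion]
    · rw [strictCount]
      congr 1
      ext i
      simp only [Finset.mem_filter, Finset.mem_biUnion]
      tauto
    · intro T hT T' hT' hne
      rw [Function.onFun, Finset.disjoint_left]
      intro i hi hi'
      simp only [Finset.mem_filter, Finset.mem_Ico] at hi hi'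
      obtain ⟨x, hx⟩ := hS.1 i (Finset.mem_Icc.2 (by omega))
      exact hne (OSP.eq_of_disjoint_carrier hd hT hT' (hi.2.1 hx) (hi'.2.1 hx))
  rw [hcount, ← Finset.prod_pow_eq_pow_sum]
  refine Finset.prod_congr rfl fun T hT => ?_
  rw [← (had T hT).card_strict_add_one hS (hsub T hT)]
  ring

/-! ### Splitting off the member that contains S_1 -/

open Classical in
/-- The ordered set partitions of `S₁ ∪ ⋯ ∪ S_i` that satisfy `p_(S_i) ≥ ⋯ ≥ p_(S₁)`. -/
noncomputable def initialChains (S : ℕ → Finset (Fin n)) (i : ℕ) : Finset (OSP n) :=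
  Finset.univ.filter (fun T => T.carrier = (Finset.Icc 1 i).biUnion S ∧
    ∀ a b : ℕ, 1 ≤ a → a ≤ b → b ≤ i → ∀ x ∈ S a, ∀ y ∈ S b, T.pos x ≤ T.pos y)

theorem mem_initialChains {S : ℕ → Finset (Fin n)} {i : ℕ} {T : OSP n} :
    T ∈ initialChains S i ↔ T.carrier = (Finset.Icc 1 i).biUnion S ∧
      ∀ a b : ℕ, 1 ≤ a → a ≤ b → b ≤ i → ∀ x ∈ S a, ∀ y ∈ S b, T.pos x ≤ T.pos y := by
  simp [initialChains]

theorem IsDisjointFamily.isAdapted_of_mem_initialChains {S : ℕ → Finset (Fin n)} {l i : ℕ}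
    (hS : IsDisjointFamily S l) (hi : i ≤ l) {T : OSP n} (hT : T ∈ initialChains S i) :
    IsAdapted S l T := by
  obtain ⟨hcar, hle⟩ := mem_initialChains.1 hT
  have hsub : Finset.Icc 1 i ⊆ Finset.Icc 1 l := Finset.Icc_subset_Icc_right hi
  have hiff : ∀ j, 1 ≤ j → j ≤ l → (S j ⊆ T.carrier ↔ j ≤ i) := fun j h1 h2 => by
    rw [hcar, hS.subset_biUnion_iff hsub (Finset.mem_Icc.2 ⟨h1, h2⟩), Finset.mem_Icc]
    omega
  refine ⟨?_, ?_, ?_⟩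
  · intro a ha x hx hxT
    rw [hcar] at hxT ⊢
    obtain ⟨b, hb, hxb⟩ := Finset.mem_biUnion.1 hxT
    rw [hS.eq_of_mem ha (hsub hb) hx hxb]
    exact Finset.subset_biUnion_of_mem S hb
  · intro a b ha hab hb _ hbT
    exact hle a b ha hab ((hiff b (by omega) hb).1 hbT)
  · intro a b c ha hab hbc hc _ hcT
    have := (hiff c (by omega) hc).1 hcT
    exact (hiff b (by omega) (by omega)).2 (by omega)

theorem biUnion_Icc_shift (S : ℕ → Finset (Fin n)) {i l : ℕ} (hi : i ≤ l) :
    (Finset.Icc 1 (l - i)).biUnion (fun j => S (i + j)) = (Finset.Icc (i + 1) l).biUnion S := by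
  ext x
  simp only [Finset.mem_biUnion, Finset.mem_Icc]
  constructor
  · rintro ⟨j, hj, hx⟩
    exact ⟨i + j, by omega, hx⟩
  · rintro ⟨j, hj, hx⟩
    refine ⟨j - i, by omega, ?_⟩
    rwa [Nat.add_sub_cancel' (by omega)]

/-- The sets with index at most i do not meet the carrier, so their conditions are vacuous. -/
theorem IsDisjointFamily.isAdapted_shift_iff {S : ℕ → Finset (Fin n)} {l i : ℕ}
    (hS : IsDisjointFamily S l) (hi : i ≤ l) {T : OSP n}
    (hT : T.carrier ⊆ (Finset.Icc (i + 1) l).biUnion S) :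
    IsAdapted (fun j => S (i + j)) (l - i) T ↔ IsAdapted S l T := by
  have hgt : ∀ a, 1 ≤ a → a ≤ l → ∀ x ∈ S a, x ∈ T.carrier → i < a := by
    intro a ha hal x hx hxT
    obtain ⟨b, hb, hxb⟩ := Finset.mem_biUnion.1 (hT hxT)
    rw [Finset.mem_Icc] at hb
    have := hS.eq_of_mem (Finset.mem_Icc.2 ⟨ha, hal⟩) (Finset.mem_Icc.2 (by omega)) hx hxb
    omega
  have hgt' : ∀ a, 1 ≤ a → a ≤ l → S a ⊆ T.carrier → i < a := by
    intro a ha hal haT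
    obtain ⟨x, hx⟩ := hS.1 a (Finset.mem_Icc.2 ⟨ha, hal⟩)
    exact hgt a ha hal x hx (haT hx)
  constructor
  · rintro ⟨h1, h2, h3⟩
    refine ⟨?_, ?_, ?_⟩
    · intro a ha x hx hxT
      rw [Finset.mem_Icc] at ha
      obtain ⟨c, rfl⟩ := Nat.exists_eq_add_of_lt (hgt a ha.1 ha.2 x hx hxT)
      exact h1 (c + 1) (Finset.mem_Icc.2 (by omega)) x hx hxT
    · intro a b ha hab hb haT hbT
      obtain ⟨c, rfl⟩ := Nat.exists_eq_add_of_lt (hgt' a ha (by omega) haT)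
      obtain ⟨d, rfl⟩ := Nat.exists_eq_add_of_lt (hgt' b (by omega) hb hbT)
      exact h2 (c + 1) (d + 1) (by omega) (by omega) (by omega) haT hbT
    · intro a b c ha hab hbc hc haT hcT
      have := hgt' a ha (by omega) haT
      obtain ⟨a, rfl⟩ := Nat.exists_eq_add_of_lt this
      obtain ⟨b, rfl⟩ := Nat.exists_eq_add_of_lt (show i < b by omega)
      obtain ⟨c, rfl⟩ := Nat.exists_eq_add_of_lt (show i < c by omega)
      exact h3 (a + 1) (b + 1) (c + 1) (by omega) (by omega) (by omega) (by omega) haT hcT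
  · rintro ⟨h1, h2, h3⟩
    refine ⟨?_, ?_, ?_⟩
    · intro a ha
      rw [Finset.mem_Icc] at ha
      exact h1 (i + a) (Finset.mem_Icc.2 (by omega))
    · intro a b ha hab hb
      exact h2 (i + a) (i + b) (by omega) (by omega) (by omega)
    · intro a b c ha hab hbc hc
      exact h3 (i + a) (i + b) (i + c) (by omega) (by omega) (by omega) (by omega)

theorem exists_mem_initialChains {S : ℕ → Finset (Fin n)} {l : ℕ} (hl : 1 ≤ l)
    (hS : IsDisjointFamily S l) {𝒯 : Finset (OSP n)} (h𝒯 : 𝒯 ∈ chainComposites S l) {T₁ : OSP n}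
    (hT₁ : T₁ ∈ firstMembers S 𝒯) : ∃ i ∈ Finset.Icc 1 l, T₁ ∈ initialChains S i := by
  obtain ⟨hT₁, hST₁⟩ := Finset.mem_filter.1 hT₁
  obtain ⟨hc, had⟩ := (mem_chainComposites hS).1 h𝒯
  obtain ⟨hd, hmem⟩ := isComposite_iff.1 hc
  obtain ⟨a, i, ha, hai, hil, hcar⟩ :=
    (had T₁ hT₁).exists_carrier_eq fun x hx => (hmem x).2 ⟨T₁, hT₁, hx⟩
  have hIcc : Finset.Icc a i ⊆ Finset.Icc 1 l := Finset.Icc_subset_Icc ha hil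
  have ha1 : a = 1 := by
    have := (hS.subset_biUnion_iff hIcc (Finset.mem_Icc.2 ⟨le_rfl, hl⟩)).1 (hcar ▸ hST₁)
    rw [Finset.mem_Icc] at this
    omega
  subst ha1
  have hin : ∀ j, 1 ≤ j → j ≤ i → S j ⊆ T₁.carrier := by
    intro j h1 h2
    rw [hcar]
    exact Finset.subset_biUnion_of_mem S (Finset.mem_Icc.2 ⟨h1, h2⟩)
  refine ⟨i, Finset.mem_Icc.2 ⟨hai, hil⟩, mem_initialChains.2 ⟨hcar, ?_⟩⟩
  intro b c hb hbc hci
  exact (had T₁ hT₁).pos_le b c hb hbc (by omega) (hin b hb (by omega)) (hin c (by omega) hci)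

/-- A composite set partition satisfying the chain of orientations consists of its first member and
a composite set partition satisfying the chain of orientations for the remaining sets. -/
theorem sum_chainComposites {S : ℕ → Finset (Fin n)} {l : ℕ} (hl : 1 ≤ l)
    (hS : IsDisjointFamily S l) (Φ : OSP n → Finset (OSP n) → ℂ) :
    ∑ 𝒯 ∈ chainComposites S l, ∑ T₁ ∈ firstMembers S 𝒯, Φ T₁ (𝒯.erase T₁) =
      ∑ i ∈ Finset.Icc 1 l, ∑ T₁ ∈ initialChains S i,
        ∑ 𝒯 ∈ chainComposites (fun j => S (i + j)) (l - i), Φ T₁ 𝒯 := by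
  have hl1 : 1 ∈ Finset.Icc 1 l := Finset.mem_Icc.2 ⟨le_rfl, hl⟩
  have hnot : ∀ i ∈ Finset.Icc 1 l, ∀ T₁ ∈ initialChains S i,
      ∀ 𝒯 ∈ chainComposites (fun j => S (i + j)) (l - i),
        ∀ T ∈ 𝒯, Disjoint T₁.carrier T.carrier := by
    intro i hi T₁ hT₁ 𝒯 h𝒯 T hT
    rw [Finset.mem_Icc] at hi
    obtain ⟨hc, -⟩ := (mem_chainComposites (hS.shift i)).1 h𝒯
    rw [biUnion_Icc_shift S hi.2] at hc
    rw [Finset.disjoint_left]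
    intro x hx hxT
    rw [(mem_initialChains.1 hT₁).1] at hx
    obtain ⟨a, ha, hxa⟩ := Finset.mem_biUnion.1 hx
    obtain ⟨b, hb, hxb⟩ := Finset.mem_biUnion.1 (((isComposite_iff.1 hc).2 x).2 ⟨T, hT, hxT⟩)
    rw [Finset.mem_Icc] at ha hb
    have := hS.eq_of_mem (Finset.mem_Icc.2 (by omega)) (Finset.mem_Icc.2 (by omega)) hxa hxb
    omega
  have hnotMem : ∀ i ∈ Finset.Icc 1 l, ∀ T₁ ∈ initialChains S i,
      ∀ 𝒯 ∈ chainComposites (fun j => S (i + j)) (l - i), T₁ ∉ 𝒯 := by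
    intro i hi T₁ hT₁ 𝒯 h𝒯 hmem
    exact T₁.carrier_nonempty.ne_empty
      (Finset.disjoint_self_iff_empty _ |>.1 (hnot i hi T₁ hT₁ 𝒯 h𝒯 T₁ hmem))
  simp_rw [Finset.sum_sigma']
  symm
  -- The index i is not recorded in the image; it is recovered as the largest index of a set
  -- contained in the carrier of T₁.
  refine Finset.sum_bij (fun p _ => ⟨insert p.2.1 p.2.2, p.2.1⟩) ?_ ?_ ?_ ?_
  · rintro ⟨i, T₁, 𝒯⟩ hp
    simp only [Finset.mem_sigma] at hp ⊢
    obtain ⟨hi, hT₁, h𝒯⟩ := hp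
    have hdisj := hnot i hi T₁ hT₁ 𝒯 h𝒯
    have hi' := Finset.mem_Icc.1 hi
    obtain ⟨hc, had⟩ := (mem_chainComposites (hS.shift i)).1 h𝒯
    rw [biUnion_Icc_shift S hi'.2] at hc
    obtain ⟨hd, hmem⟩ := isComposite_iff.1 hc
    have hcar := (mem_initialChains.1 hT₁).1
    refine ⟨(mem_chainComposites hS).2 ⟨isComposite_iff.2 ⟨?_, ?_⟩, ?_⟩, ?_⟩
    · intro T hT T' hT' hne
      rcases Finset.mem_insert.1 hT with h | h <;> rcases Finset.mem_insert.1 hT' with h' | h'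
      · exact absurd (h.trans h'.symm) hne
      · exact h ▸ hdisj T' h'
      · exact h' ▸ (hdisj T h).symm
      · exact hd T h T' h' hne
    · intro x
      have : (∃ T ∈ insert T₁ 𝒯, x ∈ T.carrier) ↔ x ∈ T₁.carrier ∨ ∃ T ∈ 𝒯, x ∈ T.carrier := by
        simp
      rw [this, ← hmem, hcar]
      simp only [Finset.mem_biUnion, Finset.mem_Icc]
      constructor
      · rintro ⟨a, ha, hx⟩
        by_cases hai : a ≤ i
        · exact Or.inl ⟨a, by omega, hx⟩
        · exact Or.inr ⟨a, by omega, hx⟩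
      · rintro (⟨a, ha, hx⟩ | ⟨a, ha, hx⟩) <;> exact ⟨a, by omega, hx⟩
    · intro T hT
      rcases Finset.mem_insert.1 hT with rfl | hT
      · exact hS.isAdapted_of_mem_initialChains hi'.2 hT₁
      · exact (hS.isAdapted_shift_iff hi'.2 fun x hx => (hmem x).2 ⟨T, hT, hx⟩).1 (had T hT)
    · refine Finset.mem_filter.2 ⟨Finset.mem_insert_self _ _, ?_⟩
      rw [hcar]
      exact Finset.subset_biUnion_of_mem S (Finset.mem_Icc.2 ⟨le_rfl, hi'.1⟩)
  · rintro ⟨i, T₁, 𝒯⟩ hp ⟨i', T₁', 𝒯'⟩ hp' heq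
    simp only [Finset.mem_sigma] at hp hp'
    obtain ⟨hi, hT₁, h𝒯⟩ := hp
    obtain ⟨hi', hT₁', h𝒯'⟩ := hp'
    simp only [Sigma.mk.injEq, heq_eq_eq] at heq
    obtain ⟨hins, rfl⟩ := heq
    have h𝒯𝒯 : 𝒯 = 𝒯' := by
      rw [← Finset.erase_insert (hnotMem i hi T₁ hT₁ 𝒯 h𝒯), hins,
        Finset.erase_insert (hnotMem i' hi' T₁ hT₁' 𝒯' h𝒯')]
    have hcar := (mem_initialChains.1 hT₁).1
    have hcar' := (mem_initialChains.1 hT₁').1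
    rw [Finset.mem_Icc] at hi hi'
    have h1 : i ≤ i' := by
      have := (hS.subset_biUnion_iff (Finset.Icc_subset_Icc_right hi'.2)
        (Finset.mem_Icc.2 hi)).1 (by
          rw [← hcar', hcar]
          exact Finset.subset_biUnion_of_mem S (Finset.mem_Icc.2 ⟨hi.1, le_rfl⟩))
      exact (Finset.mem_Icc.1 this).2
    have h2 : i' ≤ i := by
      have := (hS.subset_biUnion_iff (Finset.Icc_subset_Icc_right hi.2)
        (Finset.mem_Icc.2 hi')).1 (by
          rw [← hcar, hcar']
          exact Finset.subset_biUnion_of_mem S (Finset.mem_Icc.2 ⟨hi'.1, le_rfl⟩))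
      exact (Finset.mem_Icc.1 this).2
    obtain rfl := le_antisymm h1 h2
    rw [h𝒯𝒯]
  · rintro ⟨𝒯, T₁⟩ hp
    simp only [Finset.mem_sigma] at hp
    obtain ⟨h𝒯, hT₁m⟩ := hp
    have hT₁ := Finset.mem_of_mem_filter T₁ hT₁m
    obtain ⟨hc, had⟩ := (mem_chainComposites hS).1 h𝒯
    obtain ⟨hd, hmem⟩ := isComposite_iff.1 hc
    obtain ⟨i, hi, hT₁i⟩ := exists_mem_initialChains hl hS h𝒯 hT₁m
    have hcar := (mem_initialChains.1 hT₁i).1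
    obtain ⟨hai, hil⟩ := Finset.mem_Icc.1 hi
    have hIcc : Finset.Icc 1 i ⊆ Finset.Icc 1 l := Finset.Icc_subset_Icc_right hil
    have hin : ∀ j, 1 ≤ j → j ≤ i → S j ⊆ T₁.carrier := by
      intro j h1 h2
      rw [hcar]
      exact Finset.subset_biUnion_of_mem S (Finset.mem_Icc.2 ⟨h1, h2⟩)
    refine ⟨⟨i, T₁, 𝒯.erase T₁⟩, ?_, ?_⟩
    · simp only [Finset.mem_sigma]
      have hc' : ∀ x, x ∈ (Finset.Icc (i + 1) l).biUnion S ↔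
          ∃ T ∈ 𝒯.erase T₁, x ∈ T.carrier := by
        intro x
        constructor
        · intro hx
          obtain ⟨b, hb, hxb⟩ := Finset.mem_biUnion.1 hx
          rw [Finset.mem_Icc] at hb
          have hb' : b ∈ Finset.Icc 1 l := Finset.mem_Icc.2 (by omega)
          obtain ⟨T, hT, hxT⟩ := (hmem x).1 (Finset.mem_biUnion.2 ⟨b, hb', hxb⟩)
          refine ⟨T, Finset.mem_erase.2 ⟨?_, hT⟩, hxT⟩
          rintro rfl
          rw [hcar] at hxT
          obtain ⟨c, hc, hxc⟩ := Finset.mem_biUnion.1 hxT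
          have := hS.eq_of_mem hb' (hIcc hc) hxb hxc
          rw [Finset.mem_Icc] at hc
          omega
        · rintro ⟨T, hT, hxT⟩
          obtain ⟨hne, hT⟩ := Finset.mem_erase.1 hT
          obtain ⟨b, hb, hxb⟩ := Finset.mem_biUnion.1 ((hmem x).2 ⟨T, hT, hxT⟩)
          rw [Finset.mem_Icc] at hb
          refine Finset.mem_biUnion.2 ⟨b, Finset.mem_Icc.2 ⟨?_, hb.2⟩, hxb⟩
          by_contra hlt
          exact hne (OSP.eq_of_disjoint_carrier hd hT hT₁ hxT (hin b hb.1 (by omega) hxb))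
      refine ⟨hi, hT₁i, (mem_chainComposites (hS.shift i)).2 ⟨isComposite_iff.2 ⟨?_, ?_⟩, ?_⟩⟩
      · intro T hT T' hT'
        exact hd T (Finset.mem_of_mem_erase hT) T' (Finset.mem_of_mem_erase hT')
      · rw [biUnion_Icc_shift S hil]
        exact hc'
      · intro T hT
        exact (hS.isAdapted_shift_iff hil fun x hx => (hc' x).2 ⟨T, hT, hx⟩).2
          (had T (Finset.mem_of_mem_erase hT))
    · simp only [Finset.insert_erase hT₁]
  · rintro ⟨i, T₁, 𝒯⟩ hp
    simp only [Finset.mem_sigma] at hp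
    simp only [Finset.erase_insert (hnotMem i hp.1 T₁ hp.2.1 𝒯 hp.2.2)]

end Chain

/-! ### Prefix minima in plates, and block lists cut from the family S -/

theorem nonneg_add_min_zero_iff {s p : ℝ} : 0 ≤ s + min 0 p ↔ 0 ≤ s ∧ 0 ≤ s + p := by
  rcases min_cases 0 p with ⟨h, h'⟩ | ⟨h, h'⟩ <;> rw [h]
  · exact ⟨fun hs => ⟨by linarith, by linarith⟩, fun hs => by linarith [hs.1]⟩
  · exact ⟨fun hs => ⟨by linarith, hs⟩, fun hs => hs.2⟩

namespace BlockList

variable {n : ℕ}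

theorem forall_take_sum_nonneg_iff (x : Fin n → ℝ) (L : List (Finset (Fin n))) (s : ℝ) :
    (∀ j : ℕ, 0 ≤ s + ((L.take j).map (fun B => ∑ i ∈ B, x i)).sum) ↔
      0 ≤ s + minPrefix x L := by
  induction L generalizing s with
  | nil => simp [minPrefix]
  | cons B L ih =>
    rw [minPrefix, nonneg_add_min_zero_iff, ← add_assoc, ← ih]
    constructor
    · intro h
      refine ⟨by simpa using h 0, fun j => ?_⟩
      simpa [add_assoc] using h (j + 1)
    · rintro ⟨h0, h⟩ j
      cases j with
      | zero => simpa using h0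
      | succ j => simpa [add_assoc] using h j

theorem minPrefix_congr {x y : Fin n → ℝ} {L : List (Finset (Fin n))}
    (h : ∀ i ∈ union L, x i = y i) : minPrefix x L = minPrefix y L := by
  induction L with
  | nil => rfl
  | cons B L ih =>
    rw [minPrefix, minPrefix, ih fun i hi => h i (by simp [hi]),
      Finset.sum_congr rfl fun i hi => h i (by simp [hi])]

/-- The full union is one of the prefixes. This supplies b ≤ B for `sum_firstPassage`. -/
theorem IsOrdered.minPrefix_le {L : List (Finset (Fin n))} (hL : IsOrdered L) (x : Fin n → ℝ) :
    minPrefix x L ≤ ∑ i ∈ union L, x i := by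
  induction L with
  | nil => simp [minPrefix]
  | cons B L ih =>
    obtain ⟨-, hd, hLo⟩ := isOrdered_cons.1 hL
    rw [minPrefix, union_cons, Finset.sum_union hd]
    exact (min_le_right _ _).trans (by linarith [ih hLo])

theorem isOrdered_of_mem_quasiShuffles {us vs L : List (Finset (Fin n))} (hus : IsOrdered us)
    (hvs : IsOrdered vs) (hd : Disjoint (union us) (union vs)) (hL : L ∈ quasiShuffles us vs) :
    IsOrdered L ∧ union L = union us ∪ union vs := by
  induction us, vs using quasiShuffles.induct generalizing L with
  | case1 vs =>
    rw [quasiShuffles_nil_left, Finset.mem_singleton] at hL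
    subst hL
    exact ⟨hvs, by simp⟩
  | case2 u us =>
    rw [quasiShuffles_nil_right, Finset.mem_singleton] at hL
    subst hL
    exact ⟨hus, by simp⟩
  | case3 u us v vs ih1 ih2 ih3 =>
    obtain ⟨hu, hud, huo⟩ := isOrdered_cons.1 hus
    obtain ⟨hv, hvd, hvo⟩ := isOrdered_cons.1 hvs
    rw [quasiShuffles_cons_cons] at hL
    simp only [Finset.mem_union, Finset.mem_image] at hL
    have hd' := hd
    rw [union_cons, union_cons, Finset.disjoint_union_left, Finset.disjoint_union_right,
      Finset.disjoint_union_right] at hd'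
    obtain ⟨⟨d1, d2⟩, d3, d4⟩ := hd'
    rcases hL with ⟨M, hM, rfl⟩ | ⟨M, hM, rfl⟩ | ⟨M, hM, rfl⟩
    · obtain ⟨h1, h2⟩ := ih1 huo hvs (hd.mono_left (by simp)) hM
      refine ⟨isOrdered_cons.2 ⟨hu, ?_, h1⟩, ?_⟩
      · rw [h2, union_cons]
        simp only [Finset.disjoint_union_right]
        exact ⟨hud, d1, d2⟩
      · simp [h2, Finset.union_assoc]
    · obtain ⟨h1, h2⟩ := ih2 hus hvo (hd.mono_right (by simp)) hM
      refine ⟨isOrdered_cons.2 ⟨hv, ?_, h1⟩, ?_⟩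
      · rw [h2, union_cons]
        simp only [Finset.disjoint_union_right]
        exact ⟨⟨d1.symm, d3.symm⟩, hvd⟩
      · simp only [h2, union_cons]
        ac_rfl
    · obtain ⟨h1, h2⟩ := ih3 huo hvo d4 hM
      refine ⟨isOrdered_cons.2 ⟨hu.mono Finset.subset_union_left, ?_, h1⟩, ?_⟩
      · rw [h2]
        simp only [Finset.disjoint_union_right, Finset.disjoint_union_left]
        exact ⟨⟨hud, d3.symm⟩, d2, hvd⟩
      · simp only [h2, union_cons]
        ac_rfl

theorem union_map_range' (S : ℕ → Finset (Fin n)) (m q : ℕ) :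
    union ((List.range' m q).map S) = (Finset.Ico m (m + q)).biUnion S := by
  ext x
  simp only [mem_union, List.mem_map, Finset.mem_biUnion, Finset.mem_Ico, List.mem_range'_1]
  constructor
  · rintro ⟨_, ⟨j, hj, rfl⟩, hx⟩
    exact ⟨j, hj, hx⟩
  · rintro ⟨j, hj, hx⟩
    exact ⟨_, ⟨j, hj, rfl⟩, hx⟩

theorem _root_.IsDisjointFamily.isOrdered_map {S : ℕ → Finset (Fin n)} {k : ℕ}
    (hS : IsDisjointFamily S k) {m q : ℕ} (hm : 1 ≤ m) (hmq : m + q ≤ k + 1) :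
    IsOrdered ((List.range' m q).map S) := by
  constructor
  · intro B hB
    obtain ⟨j, hj, rfl⟩ := List.mem_map.1 hB
    rw [List.mem_range'_1] at hj
    exact hS.1 j (Finset.mem_Icc.2 (by omega))
  · rw [List.pairwise_map]
    refine List.Pairwise.imp_of_mem (fun {a b} ha hb hab => ?_) List.pairwise_lt_range'
    rw [List.mem_range'_1] at ha hb
    exact hS.2 a (Finset.mem_Icc.2 (by omega)) b (Finset.mem_Icc.2 (by omega)) hab.ne

theorem _root_.IsDisjointFamily.position_map {S : ℕ → Finset (Fin n)} {k : ℕ}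
    (hS : IsDisjointFamily S k) {m q : ℕ} (hm : 1 ≤ m) (hmq : m + q ≤ k + 1) {j : ℕ} (hj : m ≤ j)
    (hjq : j < m + q) {x : Fin n} (hx : x ∈ S j) :
    position ((List.range' m q).map S) x = j - m := by
  induction q generalizing m with
  | zero => omega
  | succ q ih =>
    rw [List.range'_succ, List.map_cons]
    by_cases hjm : j = m
    · subst hjm
      rw [position_cons_of_mem hx, Nat.sub_self]
    · rw [position_cons_of_notMem, ih (by omega) (by omega) (by omega) (by omega)]
      · omega
      · exact fun hxm => hjm (hS.eq_of_mem (Finset.mem_Icc.2 (by omega))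
          (Finset.mem_Icc.2 (by omega)) hx hxm)

theorem isMonotoneAlong_map_range' {S : ℕ → Finset (Fin n)} {L : List (Finset (Fin n))}
    {m q : ℕ} : IsMonotoneAlong L ((List.range' m q).map S) ↔
      ∀ a b : ℕ, m ≤ a → a ≤ b → b < m + q → ∀ x ∈ S a, ∀ y ∈ S b,
        position L x ≤ position L y := by
  induction q generalizing m with
  | zero =>
    refine ⟨fun _ a b h1 h2 h3 => by omega, fun _ => ?_⟩
    simp [IsMonotoneAlong]
  | succ q ih =>
    rw [List.range'_succ, List.map_cons, isMonotoneAlong_cons, ih, union_map_range']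
    constructor
    · rintro ⟨h1, h2, h3⟩ a b ha hab hb x hx y hy
      by_cases ham : a = m
      · subst ham
        by_cases hba : b = a
        · subst hba
          exact h1 x hx y hy
        · exact h2 x hx y (Finset.mem_biUnion.2 ⟨b, Finset.mem_Ico.2 (by omega), hy⟩)
      · exact h3 a b (by omega) hab (by omega) x hx y hy
    · intro h
      refine ⟨h m m le_rfl le_rfl (by omega), fun x hx y hy => ?_,
        fun a b ha hab hb => h a b (by omega) hab (by omega)⟩
      obtain ⟨b, hb, hyb⟩ := Finset.mem_biUnion.1 hy
      rw [Finset.mem_Ico] at hb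
      exact h m b le_rfl (by omega) (by omega) x hx y hyb

theorem firstNonneg_map_range' (x : Fin n → ℝ) (S : ℕ → Finset (Fin n)) (b : ℝ) (m q : ℕ) :
    FirstNonneg x b (S m) ((List.range' (m + 1) q).map S) ↔
      (∀ j, 1 ≤ j → j ≤ q → b + ∑ t ∈ Finset.range j, ∑ i ∈ S (t + m), x i < 0) ∧
        0 ≤ b + ∑ t ∈ Finset.range (q + 1), ∑ i ∈ S (t + m), x i := by
  induction q generalizing m b with
  | zero =>
    simp only [List.range'_zero, List.map_nil, FirstNonneg, zero_add, Finset.sum_range_one]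
    exact ⟨fun h => ⟨fun j h1 h2 => by omega, h⟩, fun h => h.2⟩
  | succ q ih =>
    have hstep : ∀ j, b + ∑ t ∈ Finset.range (j + 1), ∑ i ∈ S (t + m), x i =
        b + ∑ i ∈ S m, x i + ∑ t ∈ Finset.range j, ∑ i ∈ S (t + (m + 1)), x i := by
      intro j
      rw [Finset.sum_range_succ', zero_add, add_comm (∑ t ∈ Finset.range j, _), ← add_assoc]
      simp only [add_right_comm _ 1 m, add_assoc]
    rw [List.range'_succ, List.map_cons, FirstNonneg, ih, hstep]
    constructor
    · rintro ⟨h0, h1, h2⟩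
      refine ⟨fun j hj hjq => ?_, h2⟩
      obtain ⟨j, rfl⟩ := Nat.exists_eq_add_of_le' hj
      rw [hstep]
      rcases Nat.eq_zero_or_pos j with rfl | hj
      · simpa using h0
      · exact h1 j hj (by omega)
    · rintro ⟨h1, h2⟩
      refine ⟨by simpa using h1 1 le_rfl (by omega), fun j hj hjq => ?_, h2⟩
      rw [← hstep]
      exact h1 (j + 1) (by omega) (by omega)

end BlockList

/-! ### Characteristic functions of sums of plates as products -/

section Plates

variable {n : ℕ}

theorem OSP.mem_plate {T : OSP n} {x : Fin n → ℝ} :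
    x ∈ T.plate ↔ (∀ i, i ∉ T.carrier → x i = 0) ∧ ∑ i ∈ T.carrier, x i = 0 ∧
      0 ≤ BlockList.minPrefix x T.blocks := by
  have := BlockList.forall_take_sum_nonneg_iff x T.blocks 0
  simp only [zero_add] at this
  rw [← this]
  rfl

/-- With disjoint carriers the summand in each plate is forced to be the restriction of x to its
carrier. -/
theorem mem_sum_plate_iff {𝒯 : Finset (OSP n)}
    (hd : ∀ T ∈ 𝒯, ∀ T' ∈ 𝒯, T ≠ T' → Disjoint T.carrier T'.carrier) {x : Fin n → ℝ} :
    x ∈ ∑ T ∈ 𝒯, T.plate ↔ (∀ i, (∀ T ∈ 𝒯, i ∉ T.carrier) → x i = 0) ∧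
      ∀ T ∈ 𝒯, ∑ i ∈ T.carrier, x i = 0 ∧ 0 ≤ BlockList.minPrefix x T.blocks := by
  rw [Set.mem_finsetSum]
  constructor
  · rintro ⟨g, hg, rfl⟩
    have hval : ∀ T ∈ 𝒯, ∀ i ∈ T.carrier, (∑ T ∈ 𝒯, g T) i = g T i := by
      intro T hT i hi
      rw [Finset.sum_apply, Finset.sum_eq_single_of_mem T hT]
      intro T' hT' hne
      exact (OSP.mem_plate.1 (hg hT')).1 i
        (Finset.disjoint_right.1 (hd T' hT' T hT hne) hi)
    refine ⟨fun i hi => ?_, fun T hT => ?_⟩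
    · rw [Finset.sum_apply]
      exact Finset.sum_eq_zero fun T hT => (OSP.mem_plate.1 (hg hT)).1 i (hi T hT)
    · obtain ⟨-, h1, h2⟩ := OSP.mem_plate.1 (hg hT)
      rw [Finset.sum_congr rfl (hval T hT), BlockList.minPrefix_congr (hval T hT)]
      exact ⟨h1, h2⟩
  · rintro ⟨h0, h⟩
    refine ⟨fun T i => if i ∈ T.carrier then x i else 0, fun {T} hT => ?_, ?_⟩
    · have hval : ∀ i ∈ T.carrier, (if i ∈ T.carrier then x i else 0) = x i :=
        fun i hi => if_pos hi
      refine OSP.mem_plate.2 ⟨fun i hi => if_neg hi, ?_⟩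
      rw [Finset.sum_congr rfl hval, BlockList.minPrefix_congr hval]
      exact h T hT
    · funext i
      rw [Finset.sum_apply]
      by_cases hi : ∃ T ∈ 𝒯, i ∈ T.carrier
      · obtain ⟨T, hT, hiT⟩ := hi
        rw [Finset.sum_eq_single_of_mem T hT, if_pos hiT]
        intro T' hT' hne
        exact if_neg (Finset.disjoint_right.1 (hd T' hT' T hT hne) hiT)
      · push Not at hi
        rw [h0 i hi]
        exact Finset.sum_eq_zero fun T hT => if_neg (hi T hT)

/-- The value at `x` of the characteristic function of the plate labelled by `T`, when `x` is
restricted to the carrier of `T`. -/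
noncomputable def plateInd (x : Fin n → ℝ) (T : OSP n) : ℂ :=
  ind (∑ i ∈ T.carrier, x i = 0) * ind (0 ≤ BlockList.minPrefix x T.blocks)

theorem charFun_apply (C : Set (Fin n → ℝ)) (x : Fin n → ℝ) : charFun C x = ind (x ∈ C) := by
  by_cases h : x ∈ C
  · rw [ind_of_true h, charFun, Set.indicator_of_mem h, Pi.one_apply]
  · rw [ind_of_not h, charFun, Set.indicator_of_notMem h]

theorem ind_forall_mem {ι : Type*} (s : Finset ι) (p : ι → Prop) :
    ind (∀ i ∈ s, p i) = ∏ i ∈ s, ind (p i) := by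
  by_cases h : ∀ i ∈ s, p i
  · rw [ind_of_true h, Finset.prod_eq_one fun i hi => ind_of_true (h i hi)]
  · rw [ind_of_not h]
    push Not at h
    obtain ⟨i, hi, hpi⟩ := h
    exact (Finset.prod_eq_zero hi (ind_of_not hpi)).symm

/-- The carriers cover all labels, so the requirement that x vanish elsewhere is void and only the
factors of the members remain. -/
theorem convPlates_apply {𝒯 : Finset (OSP n)} (h : IsComposite 𝒯 Finset.univ) (x : Fin n → ℝ) :
    convPlates 𝒯 x = ∏ T ∈ 𝒯, plateInd x T := by
  obtain ⟨hd, hmem⟩ := isComposite_iff.1 h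
  have h0 : ∀ i, (∀ T ∈ 𝒯, i ∉ T.carrier) → x i = 0 := by
    intro i hi
    obtain ⟨T, hT, hiT⟩ := (hmem i).1 (Finset.mem_univ i)
    exact absurd hiT (hi T hT)
  rw [convPlates, charFun_apply, ind_congr (mem_sum_plate_iff hd),
    ind_congr (and_iff_right h0), ind_forall_mem]
  exact Finset.prod_congr rfl fun T _ => ind_and _ _

end Plates

/-! ### Signed sums over chains, evaluated by first passage of partial sums -/

section Sums

variable {n : ℕ}

/-- The sum of the coordinates of `x` over `S₁ ∪ ⋯ ∪ S_j`. -/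
noncomputable def partialSum (x : Fin n → ℝ) (S : ℕ → Finset (Fin n)) (j : ℕ) : ℝ :=
  ∑ t ∈ Finset.range j, ∑ i ∈ S (t + 1), x i

theorem partialSum_shift (x : Fin n → ℝ) (S : ℕ → Finset (Fin n)) (i j : ℕ) :
    partialSum x S (i + j) = partialSum x S i + partialSum x (fun a => S (i + a)) j := by
  rw [partialSum, Finset.sum_range_add]
  rfl

theorem partialSum_shift_iff (x : Fin n → ℝ) (S : ℕ → Finset (Fin n)) {i l : ℕ} (hi : i ≤ l) :
    (partialSum x (fun j => S (i + j)) (l - i) = 0 ∧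
      ∀ j ≤ l - i, partialSum x (fun j => S (i + j)) j ≤ 0) ↔
    (partialSum x S l = partialSum x S i ∧
      ∀ j, i ≤ j → j ≤ l → partialSum x S j ≤ partialSum x S i) := by
  have hj : ∀ j, i ≤ j → partialSum x S j =
      partialSum x S i + partialSum x (fun j => S (i + j)) (j - i) := by
    intro j hj
    rw [← partialSum_shift, Nat.add_sub_cancel' hj]
  constructor
  · rintro ⟨h1, h2⟩
    refine ⟨by rw [hj l hi, h1, add_zero], fun j hij hjl => ?_⟩
    linarith [hj j hij, h2 (j - i) (by omega)]
  · rintro ⟨h1, h2⟩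
    refine ⟨by linarith [hj l hi], fun j hjl => ?_⟩
    linarith [partialSum_shift x S i j, h2 (i + j) (by omega) (by omega)]

theorem IsDisjointFamily.sum_biUnion {S : ℕ → Finset (Fin n)} {l : ℕ}
    (hS : IsDisjointFamily S l) (x : Fin n → ℝ) :
    ∑ i ∈ (Finset.Icc 1 l).biUnion S, x i = partialSum x S l := by
  rw [Finset.sum_biUnion (fun a ha b hb hab => hS.2 a ha b hb hab), partialSum]
  rw [Finset.range_eq_Ico, Finset.sum_Ico_add' (fun t => ∑ i ∈ S t, x i)]
  rfl

/-- The initial chains are the coarsenings of (S_1, …, S_l), so `sum_coarsenings` applies and yields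
first passage through the level -b. -/
theorem IsDisjointFamily.sum_initialChains {S : ℕ → Finset (Fin n)} {l : ℕ}
    (hS : IsDisjointFamily S l) (hl : 1 ≤ l) (x : Fin n → ℝ) (b : ℝ) :
    ∑ T ∈ initialChains S l,
        (-1 : ℂ) ^ (T.len + 1) * ind (0 ≤ b + BlockList.minPrefixPos x T.blocks) =
      ind ((∀ j, 1 ≤ j → j < l → b + partialSum x S j < 0) ∧ 0 ≤ b + partialSum x S l) := by
  obtain ⟨q, rfl⟩ := Nat.exists_eq_add_of_le' hl
  have hlist : S 1 :: (List.range' (1 + 1) q).map S = (List.range' 1 (q + 1)).map S := by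
    rw [List.range'_succ, List.map_cons]
  have hord : BlockList.IsOrdered (S 1 :: (List.range' (1 + 1) q).map S) := by
    rw [hlist]
    exact hS.isOrdered_map le_rfl (by omega)
  have hunion : BlockList.union (S 1 :: (List.range' (1 + 1) q).map S) =
      (Finset.Icc 1 (q + 1)).biUnion S := by
    rw [hlist, BlockList.union_map_range']
    congr 1
    ext j
    simp only [Finset.mem_Ico, Finset.mem_Icc]
    omega
  have hmem : ∀ L : List (Finset (Fin n)),
      L ∈ BlockList.coarsenings (S 1) ((List.range' (1 + 1) q).map S) ↔
      BlockList.IsOrdered L ∧ BlockList.union L = (Finset.Icc 1 (q + 1)).biUnion S ∧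
        ∀ a b : ℕ, 1 ≤ a → a ≤ b → b ≤ q + 1 → ∀ x ∈ S a, ∀ y ∈ S b,
          BlockList.position L x ≤ BlockList.position L y := by
    intro L
    rw [hord.mem_coarsenings, hunion, hlist, BlockList.isMonotoneAlong_map_range']
    refine and_congr Iff.rfl (and_congr Iff.rfl (forall₄_congr fun a b _ _ => ?_))
    rw [show b < 1 + (q + 1) ↔ b ≤ q + 1 by omega]
  have hsum := BlockList.sum_coarsenings x b hord
  rw [ind_congr (BlockList.firstNonneg_map_range' x S b 1 q)] at hsum
  have hgoal : ((∀ j, 1 ≤ j → j < q + 1 → b + partialSum x S j < 0) ∧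
      0 ≤ b + partialSum x S (q + 1)) ↔
      ((∀ j, 1 ≤ j → j ≤ q → b + ∑ t ∈ Finset.range j, ∑ i ∈ S (t + 1), x i < 0) ∧
        0 ≤ b + ∑ t ∈ Finset.range (q + 1), ∑ i ∈ S (t + 1), x i) := by
    simp only [Nat.lt_succ_iff, partialSum]
  rw [ind_congr hgoal, ← hsum]
  refine Finset.sum_bij (fun T _ => T.blocks) ?_ ?_ ?_ ?_
  · intro T hT
    obtain ⟨hcar, hle⟩ := mem_initialChains.1 hT
    exact (hmem _).2 ⟨T.isOrdered, hcar, hle⟩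
  · intro T _ T' _ h
    exact OSP.blocks_injective h
  · intro L hL
    obtain ⟨hLo, hu, hle⟩ := (hmem L).1 hL
    have hne : L ≠ [] := by
      obtain ⟨C, M, rfl, -⟩ := BlockList.exists_cons_of_mem_coarsenings hL
      exact List.cons_ne_nil _ _
    exact ⟨⟨L, hne, hLo.1, hLo.2⟩, mem_initialChains.2 ⟨hu, hle⟩, rfl⟩
  · intro T _
    rfl

/-- The sum over the composite set partitions satisfying the chain of orientations is evaluated
along the first passage of the partial sums through the level `-b`. -/
theorem sum_firstPassage (Y : ℕ → ℝ) (l : ℕ) {b B : ℝ} (hb : b ≤ B) :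
    ∑ i ∈ Finset.Icc 1 l, ind ((∀ j, 1 ≤ j → j < i → b + Y j < 0) ∧ 0 ≤ b + Y i) *
        (ind (Y i + B = 0) * ind (Y l = Y i ∧ ∀ j, i ≤ j → j ≤ l → Y j ≤ Y i)) =
      ind (1 ≤ l ∧ Y l + B = 0 ∧ 0 ≤ b + Y l ∧ ∀ j, 1 ≤ j → j ≤ l → Y j ≤ Y l) := by
  classical
  -- The least such i is the only index whose term can be nonzero.
  by_cases h : ∃ i, (1 ≤ i ∧ i ≤ l) ∧ 0 ≤ b + Y i
  · obtain ⟨⟨h1, hl⟩, hY⟩ := Nat.find_spec h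
    have hmin : ∀ j, 1 ≤ j → j < Nat.find h → b + Y j < 0 := by
      intro j hj hjf
      have := Nat.find_min h hjf
      by_contra hneg
      exact this ⟨⟨hj, by omega⟩, not_lt.1 hneg⟩
    generalize Nat.find h = i at *
    rw [Finset.sum_eq_single_of_mem i (Finset.mem_Icc.2 ⟨h1, hl⟩), ind_of_true ⟨hmin, hY⟩, one_mul,
      ← ind_and]
    · refine ind_congr ⟨?_, ?_⟩
      · rintro ⟨hB, hli, hle⟩
        refine ⟨h1.trans hl, by rw [hli, hB], by rw [hli]; exact hY, fun j hj hjl => ?_⟩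
        rw [hli]
        by_cases hij : i ≤ j
        · exact hle j hij hjl
        · linarith [hmin j hj (not_le.1 hij)]
      · rintro ⟨-, hB, hbl, hle⟩
        have := hle i h1 hl
        -- From Y_l = -B ≤ -b ≤ Y_i ≤ Y_l; the only use of b ≤ B.
        have hli : Y l = Y i := by linarith
        exact ⟨by rw [← hli, hB], hli, fun j hij hjl => hli ▸ hle j (h1.trans hij) hjl⟩
    · intro i' hi' hne
      rw [ind_of_not, zero_mul]
      rintro ⟨hlt, hge⟩
      rw [Finset.mem_Icc] at hi'
      rcases lt_or_gt_of_ne hne with hi | hi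
      · linarith [hmin i' hi'.1 hi]
      · linarith [hlt i h1 hi]
  · rw [ind_of_not]
    · refine Finset.sum_eq_zero fun i hi => ?_
      rw [ind_of_not, zero_mul]
      exact fun hi' => h ⟨i, Finset.mem_Icc.1 hi, hi'.2⟩
    · rintro ⟨h1, -, h2, -⟩
      exact h ⟨l, ⟨h1, le_rfl⟩, h2⟩

theorem exists_firstMembers_eq {S : ℕ → Finset (Fin n)} {l : ℕ} (hS : IsDisjointFamily S l)
    (hl : 1 ≤ l) {𝒯 : Finset (OSP n)} (h𝒯 : 𝒯 ∈ chainComposites S l) :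
    ∃ T₁ ∈ 𝒯, firstMembers S 𝒯 = {T₁} := by
  obtain ⟨hc, had⟩ := (mem_chainComposites hS).1 h𝒯
  obtain ⟨hd, hmem⟩ := isComposite_iff.1 hc
  have hl1 : 1 ∈ Finset.Icc 1 l := Finset.mem_Icc.2 ⟨le_rfl, hl⟩
  obtain ⟨x, hx⟩ := hS.1 1 hl1
  obtain ⟨T, hT, hxT⟩ := (hmem x).1 (Finset.mem_biUnion.2 ⟨1, hl1, hx⟩)
  refine ⟨T, hT, ?_⟩
  ext T'
  rw [firstMembers, Finset.mem_filter, Finset.mem_singleton]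
  constructor
  · rintro ⟨hT', hsub⟩
    exact OSP.eq_of_disjoint_carrier hd hT' hT (hsub hx) hxT
  · rintro rfl
    exact ⟨hT, (had _ hT).subset 1 hl1 x hx hxT⟩

theorem plateInd_eq (x : Fin n → ℝ) (T : OSP n) :
    plateInd x T =
      ind (∑ i ∈ T.carrier, x i = 0) * ind (0 ≤ 0 + BlockList.minPrefixPos x T.blocks) := by
  rw [plateInd, BlockList.minPrefix_eq, zero_add]
  congr 1
  refine ind_congr ?_
  rw [le_min_iff]
  exact and_iff_right le_rfl

/-- Strong induction on the number of sets: the first member ends at some i, the induction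
hypothesis evaluates the rest, and `sum_firstPassage` collects the sum over i. -/
theorem sum_chainComposites_prod_plateInd {S : ℕ → Finset (Fin n)} {l : ℕ}
    (hS : IsDisjointFamily S l) (x : Fin n → ℝ) :
    ∑ 𝒯 ∈ chainComposites S l, ∏ T ∈ 𝒯, ((-1 : ℂ) ^ (T.len + 1) * plateInd x T) =
      ind (partialSum x S l = 0 ∧ ∀ j ≤ l, partialSum x S j ≤ 0) := by
  induction l using Nat.strong_induction_on generalizing S with
  | _ l ih =>
    have hY0 : partialSum x S 0 = 0 := by simp [partialSum]
    rcases Nat.eq_zero_or_pos l with rfl | hl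
    · have hCC : chainComposites S 0 = {∅} := by
        ext 𝒯
        rw [mem_chainComposites hS, Finset.mem_singleton]
        constructor
        · rintro ⟨hc, -⟩
          rw [Finset.eq_empty_iff_forall_notMem]
          intro T hT
          obtain ⟨y, hy⟩ := T.carrier_nonempty
          simpa using ((isComposite_iff.1 hc).2 y).2 ⟨T, hT, hy⟩
        · rintro rfl
          exact ⟨isComposite_iff.2 (by simp), by simp⟩
      rw [hCC, Finset.sum_singleton, Finset.prod_empty, ind_of_true]
      refine ⟨hY0, fun j hj => ?_⟩
      rw [Nat.le_zero.1 hj, hY0]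
    · have hsplit : ∀ 𝒯 ∈ chainComposites S l,
          ∏ T ∈ 𝒯, ((-1 : ℂ) ^ (T.len + 1) * plateInd x T) =
          ∑ T₁ ∈ firstMembers S 𝒯, ((-1 : ℂ) ^ (T₁.len + 1) * plateInd x T₁) *
            ∏ T ∈ 𝒯.erase T₁, ((-1 : ℂ) ^ (T.len + 1) * plateInd x T) := by
        intro 𝒯 h𝒯
        obtain ⟨T₁, hT₁, h⟩ := exists_firstMembers_eq hS hl h𝒯
        rw [h, Finset.sum_singleton]
        exact (Finset.mul_prod_erase 𝒯 (fun T => (-1 : ℂ) ^ (T.len + 1) * plateInd x T) hT₁).symm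
      rw [Finset.sum_congr rfl hsplit, sum_chainComposites hl hS (fun T₁ 𝒯 =>
        ((-1 : ℂ) ^ (T₁.len + 1) * plateInd x T₁) *
          ∏ T ∈ 𝒯, ((-1 : ℂ) ^ (T.len + 1) * plateInd x T))]
      -- No sets follow the chain here, so b = B = 0.
      have hpass := sum_firstPassage (partialSum x S) l (le_refl (0 : ℝ))
      rw [show (1 ≤ l ∧ partialSum x S l + 0 = 0 ∧ 0 ≤ 0 + partialSum x S l ∧
          ∀ j, 1 ≤ j → j ≤ l → partialSum x S j ≤ partialSum x S l) ↔
          (partialSum x S l = 0 ∧ ∀ j ≤ l, partialSum x S j ≤ 0) from ?_] at hpass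
      · rw [← hpass]
        refine Finset.sum_congr rfl fun i hi => ?_
        rw [Finset.mem_Icc] at hi
        rw [← (hS.mono hi.2).sum_initialChains hi.1, Finset.sum_mul]
        refine Finset.sum_congr rfl fun T hT => ?_
        rw [← Finset.mul_sum, ih (l - i) (by omega) (hS.shift i), plateInd_eq,
          (mem_initialChains.1 hT).1, (hS.mono hi.2).sum_biUnion, add_zero]
        have hshift : (partialSum x (fun j => S (i + j)) (l - i) = 0 ∧
            ∀ j ≤ l - i, partialSum x (fun j => S (i + j)) j ≤ 0) ↔
            (partialSum x S l = partialSum x S i ∧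
              ∀ j, i ≤ j → j ≤ l → partialSum x S j ≤ partialSum x S i) :=
          partialSum_shift_iff x S hi.2
        rw [ind_congr hshift]
        ring
      · constructor
        · rintro ⟨-, h1, -, h2⟩
          rw [add_zero] at h1
          refine ⟨h1, fun j hj => ?_⟩
          rcases Nat.eq_zero_or_pos j with rfl | hj0
          · exact hY0.le
          · exact h1 ▸ h2 j hj0 hj
        · rintro ⟨h1, h2⟩
          exact ⟨hl, by rw [h1, add_zero], by rw [h1, add_zero],
            fun j _ hj => h1 ▸ h2 j hj⟩

end Sums

/-! ### The plates π as quasi-shuffles, and their alternating sum -/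

section OrientedPlates

variable {n : ℕ}

theorem OSP.pos_eq_zero_iff {T : OSP n} {B : Finset (Fin n)} {L : List (Finset (Fin n))}
    (h : T.blocks = B :: L) {x : Fin n} : T.pos x = 0 ↔ x ∈ B := by
  rw [T.pos_eq_position, h, BlockList.position_cons_eq_zero]

theorem mem_orientedPlates {S : ℕ → Finset (Fin n)} {l k : ℕ} {T₁ π : OSP n} :
    π ∈ orientedPlates S l k T₁ ↔
      π.carrier = T₁.carrier ∪ (Finset.Icc (l + 1) k).biUnion S ∧
      (∀ x ∈ T₁.carrier, ∀ y ∈ T₁.carrier, (π.pos x < π.pos y ↔ T₁.pos x < T₁.pos y)) ∧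
      (∀ j ∈ Finset.Icc (l + 1) k, π.SameBlock (S j)) ∧
      (l < k → π.BlockLT (S 1) (S (l + 1))) ∧
      (∀ j ∈ Finset.Ico (l + 1) k, π.BlockLT (S j) (S (j + 1))) := by
  simp [orientedPlates]

theorem blockLT_of_mem_orientedPlates {S : ℕ → Finset (Fin n)} {l k : ℕ}
    (hS : IsDisjointFamily S k) {T₁ π : OSP n} (hπ : π ∈ orientedPlates S l k T₁) {a b : ℕ}
    (ha : l + 1 ≤ a) (hab : a < b) (hb : b ≤ k) : π.BlockLT (S a) (S b) := by
  obtain ⟨-, -, -, -, h⟩ := mem_orientedPlates.1 hπ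
  induction b, Nat.succ_le_of_lt hab using Nat.le_induction with
  | base => exact h a (Finset.mem_Ico.2 (by omega))
  | succ b hab' ih =>
    intro x hx y hy
    obtain ⟨z, hz⟩ := hS.1 b (Finset.mem_Icc.2 (by omega))
    exact (ih (by omega) (by omega) x hx z hz).trans
      (h b (Finset.mem_Ico.2 (by omega)) z hz y hy)

theorem blockLT_first_of_mem_orientedPlates {S : ℕ → Finset (Fin n)} {l k : ℕ}
    (hS : IsDisjointFamily S k) {T₁ π : OSP n} (hπ : π ∈ orientedPlates S l k T₁) {b : ℕ}
    (hb : l + 1 ≤ b) (hbk : b ≤ k) : π.BlockLT (S 1) (S b) := by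
  obtain ⟨-, -, -, h, -⟩ := mem_orientedPlates.1 hπ
  rcases hb.eq_or_lt with rfl | hlt
  · exact h (by omega)
  · intro x hx y hy
    obtain ⟨z, hz⟩ := hS.1 (l + 1) (Finset.mem_Icc.2 (by omega))
    exact (h (by omega) x hx z hz).trans
      (blockLT_of_mem_orientedPlates hS hπ le_rfl hlt hbk z hz y hy)

theorem union_map_range'_sub (S : ℕ → Finset (Fin n)) {l k : ℕ} (hlk : l ≤ k) :
    BlockList.union ((List.range' (l + 1) (k - l)).map S) =
      (Finset.Icc (l + 1) k).biUnion S := by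
  rw [BlockList.union_map_range']
  congr 1
  ext j
  simp only [Finset.mem_Ico, Finset.mem_Icc]
  omega

/-- The labels of the oriented plates arise from the quasi-shuffles of the blocks of `T₁` after the
first one with `S_{l+1}, …, S_k`. -/
theorem mem_orientedPlates_iff_exists {S : ℕ → Finset (Fin n)} {l k : ℕ} (hl : 1 ≤ l)
    (hlk : l ≤ k) (hS : IsDisjointFamily S k) {T₁ : OSP n} {u : Finset (Fin n)}
    {us : List (Finset (Fin n))} (hT₁ : T₁.blocks = u :: us) (hSu : S 1 ⊆ u)
    (hdisj : Disjoint T₁.carrier ((Finset.Icc (l + 1) k).biUnion S)) {π : OSP n} :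
    π ∈ orientedPlates S l k T₁ ↔
      ∃ L ∈ BlockList.quasiShuffles us ((List.range' (l + 1) (k - l)).map S),
        π.blocks = u :: L := by
  set A := T₁.carrier with hA
  set A' := (Finset.Icc (l + 1) k).biUnion S with hA'
  set vs := (List.range' (l + 1) (k - l)).map S with hvs
  have hvsu : BlockList.union vs = A' := union_map_range'_sub S hlk
  have hvso : BlockList.IsOrdered vs := hS.isOrdered_map (by omega) (by omega)
  have hvsp : ∀ j, l + 1 ≤ j → j ≤ k → ∀ x ∈ S j, BlockList.position vs x = j - (l + 1) :=
    fun j h1 h2 x hx => hS.position_map (by omega) (by omega) h1 (by omega) hx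
  have hAu : A = u ∪ BlockList.union us := by
    rw [hA, T₁.carrier_eq_union, hT₁, BlockList.union_cons]
  have hT₁o := T₁.isOrdered
  rw [hT₁] at hT₁o
  obtain ⟨hu, hud, huso⟩ := BlockList.isOrdered_cons.1 hT₁o
  have huA : u ⊆ A := hAu ▸ Finset.subset_union_left
  have husA : ∀ B ∈ us, B.Nonempty ∧ B ⊆ A := fun B hB =>
    ⟨huso.1 B hB, fun y hy => by
      rw [hAu]
      exact Finset.mem_union_right _ (BlockList.mem_union.2 ⟨B, hB, hy⟩)⟩
  have hvsA : ∀ B ∈ vs, B.Nonempty ∧ B ⊆ A' := fun B hB =>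
    ⟨hvso.1 B hB, fun y hy => hvsu ▸ BlockList.mem_union.2 ⟨B, hB, hy⟩⟩
  constructor
  · intro hπ
    obtain ⟨hcar, hind, hsame, -, -⟩ := mem_orientedPlates.1 hπ
    have hrA : BlockList.restrict A π.blocks = u :: us := by
      rw [← hT₁]
      refine (π.isOrdered.restrict A).ext T₁.isOrdered ?_ ?_
      · rw [BlockList.union_restrict, ← π.carrier_eq_union, hcar, ← T₁.carrier_eq_union, ← hA]
        exact Finset.inter_eq_right.2 Finset.subset_union_left
      · intro x hx y hy
        rw [BlockList.union_restrict, Finset.mem_inter] at hx hy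
        rw [BlockList.position_restrict_lt hx.2 hy.2]
        exact hind x hx.2 y hy.2
    have hrA' : BlockList.restrict A' π.blocks = vs := by
      refine (π.isOrdered.restrict A').ext hvso ?_ ?_
      · rw [BlockList.union_restrict, ← π.carrier_eq_union, hcar, hvsu]
        exact Finset.inter_eq_right.2 Finset.subset_union_right
      · intro x hx y hy
        rw [BlockList.union_restrict, Finset.mem_inter] at hx hy
        rw [BlockList.position_restrict_lt hx.2 hy.2]
        obtain ⟨a, ha, hxa⟩ := Finset.mem_biUnion.1 hx.2
        obtain ⟨b, hb, hyb⟩ := Finset.mem_biUnion.1 hy.2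
        have ha' := Finset.mem_Icc.1 ha
        have hb' := Finset.mem_Icc.1 hb
        rw [hvsp a ha'.1 ha'.2 x hxa, hvsp b hb'.1 hb'.2 y hyb, ← π.pos_eq_position,
          ← π.pos_eq_position]
        rcases lt_trichotomy a b with hab | rfl | hab
        · exact iff_of_true (blockLT_of_mem_orientedPlates hS hπ ha'.1 hab hb'.2 x hxa y hyb)
            (by omega)
        · exact iff_of_false (hsame a ha x hxa y hyb).not_lt (lt_irrefl _)
        · exact iff_of_false
            (blockLT_of_mem_orientedPlates hS hπ hb'.1 hab ha'.2 y hyb x hxa).not_gt (by omega)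
    cases hπb : π.blocks with
    | nil => exact absurd hπb π.ne_nil
    | cons B L =>
      obtain ⟨z, hz⟩ := hS.1 1 (Finset.mem_Icc.2 (by omega))
      have hBsub : ∀ C ∈ B :: L, C.Nonempty ∧ C ⊆ A ∪ A' := fun C hC =>
        ⟨π.nonempty_of_mem C (hπb ▸ hC), fun y hy => by
          rw [← hcar, π.carrier_eq_union, hπb]
          exact BlockList.mem_union.2 ⟨C, hC, hy⟩⟩
      -- S_1 precedes S_{l+1}, …, S_k strictly, and nothing precedes the first block; hence the
      -- first block is that of T₁, unmerged.
      have hBA : Disjoint B A' := by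
        rw [Finset.disjoint_left]
        intro y hyB hyA'
        obtain ⟨b, hb, hyb⟩ := Finset.mem_biUnion.1 hyA'
        rw [Finset.mem_Icc] at hb
        have := blockLT_first_of_mem_orientedPlates hS hπ hb.1 hb.2 z hz y hyb
        rw [(OSP.pos_eq_zero_iff hπb).2 hyB] at this
        exact Nat.not_lt_zero _ this
      have hBA1 : B ∩ A = B := by
        rw [Finset.inter_eq_left]
        intro y hy
        rcases Finset.mem_union.1 ((hBsub B (by simp)).2 hy) with h | h
        · exact h
        · exact absurd h (Finset.disjoint_left.1 hBA hy)
      rw [hπb, BlockList.restrict, hBA1, if_pos (hBsub B (by simp)).1] at hrA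
      rw [hπb, BlockList.restrict, Finset.disjoint_iff_inter_eq_empty.1 hBA, if_neg (by simp)]
        at hrA'
      obtain ⟨rfl, hL⟩ := List.cons.inj hrA
      refine ⟨L, ?_, rfl⟩
      rw [← hL, ← hrA']
      exact BlockList.mem_quasiShuffles_restrict fun C hC => hBsub C (by simp [hC])
  · rintro ⟨L, hL, hπb⟩
    obtain ⟨-, hrA, hrA'⟩ := BlockList.restrict_of_mem_quasiShuffles hdisj husA hvsA hL
    have hduv : Disjoint (BlockList.union us) (BlockList.union vs) := by
      rw [hvsu]
      exact hdisj.mono_left (hAu ▸ Finset.subset_union_right)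
    obtain ⟨-, hLu⟩ := BlockList.isOrdered_of_mem_quasiShuffles huso hvso hduv hL
    have huA' : Disjoint u A' := hdisj.mono_left huA
    have hπA : BlockList.restrict A π.blocks = T₁.blocks := by
      rw [hπb, BlockList.restrict, Finset.inter_eq_left.2 huA, if_pos hu, hrA, hT₁]
    have hπA' : BlockList.restrict A' π.blocks = vs := by
      rw [hπb, BlockList.restrict, Finset.disjoint_iff_inter_eq_empty.1 huA', if_neg (by simp),
        hrA']
    have hlt : ∀ a b, l + 1 ≤ a → a ≤ k → l + 1 ≤ b → b ≤ k → ∀ x ∈ S a, ∀ y ∈ S b,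
        (π.pos x < π.pos y ↔ a < b) := by
      intro a b ha hak hb hbk x hx y hy
      have hx' : x ∈ A' := Finset.mem_biUnion.2 ⟨a, Finset.mem_Icc.2 ⟨ha, hak⟩, hx⟩
      have hy' : y ∈ A' := Finset.mem_biUnion.2 ⟨b, Finset.mem_Icc.2 ⟨hb, hbk⟩, hy⟩
      rw [π.pos_eq_position, π.pos_eq_position, ← BlockList.position_restrict_lt hx' hy', hπA',
        hvsp a ha hak x hx, hvsp b hb hbk y hy]
      omega
    refine mem_orientedPlates.2 ⟨?_, ?_, ?_, ?_, ?_⟩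
    · rw [π.carrier_eq_union, hπb, BlockList.union_cons, hLu, ← Finset.union_assoc, hvsu, ← hAu]
    · intro x hx y hy
      rw [π.pos_eq_position, π.pos_eq_position, ← BlockList.position_restrict_lt hx hy, hπA]
      rfl
    · intro j hj x hx y hy
      rw [Finset.mem_Icc] at hj
      refine le_antisymm (not_lt.1 ?_) (not_lt.1 ?_) <;>
      · rw [hlt j j hj.1 hj.2 hj.1 hj.2 _ (by assumption) _ (by assumption)]
        exact lt_irrefl j
    · intro hlk' x hx y hy
      rw [(OSP.pos_eq_zero_iff hπb).2 (hSu hx), Nat.pos_iff_ne_zero, Ne,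
        OSP.pos_eq_zero_iff hπb]
      exact Finset.disjoint_right.1 huA'
        (Finset.mem_biUnion.2 ⟨l + 1, Finset.mem_Icc.2 ⟨le_rfl, hlk'⟩, hy⟩)
    · intro j hj x hx y hy
      rw [Finset.mem_Ico] at hj
      rw [hlt j (j + 1) (by omega) (by omega) (by omega) (by omega) x hx y hy]
      exact Nat.lt_succ_self j

/-- All π share the first block u, so this is `sum_quasiShuffles` for the tails with shift s the sum
over u. Dropping u shortens both T₁ and π by one and preserves the sign. -/
theorem sum_orientedPlates {S : ℕ → Finset (Fin n)} {l k : ℕ} (hl : 1 ≤ l)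
    (hlk : l ≤ k) (hS : IsDisjointFamily S k) {T₁ : OSP n} {u : Finset (Fin n)}
    {us : List (Finset (Fin n))} (hT₁ : T₁.blocks = u :: us) (hSu : S 1 ⊆ u)
    (hdisj : Disjoint T₁.carrier ((Finset.Icc (l + 1) k).biUnion S)) (x : Fin n → ℝ) :
    ∑ π ∈ orientedPlates S l k T₁,
        (-1 : ℂ) ^ (T₁.len + (k - l) + π.len) * ind (0 ≤ BlockList.minPrefix x π.blocks) =
      ind (0 ≤ BlockList.minPrefix x ((List.range' (l + 1) (k - l)).map S) +
        BlockList.minPrefixPos x T₁.blocks) := by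
  have hmem := fun π : OSP n => mem_orientedPlates_iff_exists (π := π) hl hlk hS hT₁ hSu hdisj
  have hvsu := union_map_range'_sub S hlk
  have hvslen : ((List.range' (l + 1) (k - l)).map S).length = k - l := by simp
  have hvso : BlockList.IsOrdered ((List.range' (l + 1) (k - l)).map S) :=
    hS.isOrdered_map (by omega) (by omega)
  generalize (List.range' (l + 1) (k - l)).map S = vs at *
  have hcar : T₁.carrier = u ∪ BlockList.union us := by
    rw [T₁.carrier_eq_union, hT₁, BlockList.union_cons]
  rw [← hvsu, hcar, Finset.disjoint_union_left] at hdisj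
  have hT₁o := T₁.isOrdered
  rw [hT₁] at hT₁o
  obtain ⟨hu, hud, huso⟩ := BlockList.isOrdered_cons.1 hT₁o
  have hsum := BlockList.sum_quasiShuffles x huso.1 hvso.1 hdisj.2 (∑ i ∈ u, x i)
  have hgoal : BlockList.minPrefix x vs + BlockList.minPrefixPos x T₁.blocks =
      ∑ i ∈ u, x i + BlockList.minPrefix x us + BlockList.minPrefix x vs := by
    rw [hT₁, BlockList.minPrefixPos, add_comm]
  rw [hgoal, ← hsum]
  refine Finset.sum_bij (fun π _ => π.blocks.tail) ?_ ?_ ?_ ?_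
  · intro π hπ
    obtain ⟨L, hL, hπb⟩ := (hmem π).1 hπ
    rwa [hπb]
  · intro π hπ π' hπ' h
    obtain ⟨L, -, hπb⟩ := (hmem π).1 hπ
    obtain ⟨L', -, hπb'⟩ := (hmem π').1 hπ'
    rw [hπb, hπb', List.tail_cons, List.tail_cons] at h
    exact OSP.blocks_injective (by rw [hπb, hπb', h])
  · intro L hL
    obtain ⟨hLo, hLu⟩ := BlockList.isOrdered_of_mem_quasiShuffles huso hvso hdisj.2 hL
    have hord : BlockList.IsOrdered (u :: L) := by
      refine BlockList.isOrdered_cons.2 ⟨hu, ?_, hLo⟩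
      rw [hLu]
      exact Finset.disjoint_union_right.2 ⟨hud, hdisj.1⟩
    exact ⟨⟨u :: L, List.cons_ne_nil _ _, hord.1, hord.2⟩, (hmem _).2 ⟨L, hL, rfl⟩, rfl⟩
  · intro π hπ
    obtain ⟨L, -, hπb⟩ := (hmem π).1 hπ
    rw [OSP.len, OSP.len, hπb, hT₁, List.tail_cons, hvslen, List.length_cons, List.length_cons,
      BlockList.minPrefix]
    congr 1
    · ring
    · refine ind_congr ?_
      rw [le_min_iff]
      exact and_iff_right le_rfl

end OrientedPlates

/-! ### Assembly of the expansion and standardness of its terms -/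

section Main

variable {n : ℕ}

theorem exists_blocks_eq_of_mem_initialChains {S : ℕ → Finset (Fin n)} {i : ℕ} {T₁ : OSP n}
    (hT₁ : T₁ ∈ initialChains S i) : ∃ u us, T₁.blocks = u :: us ∧ S 1 ⊆ u := by
  obtain ⟨hcar, hle⟩ := mem_initialChains.1 hT₁
  cases h : T₁.blocks with
  | nil => exact absurd h T₁.ne_nil
  | cons u us =>
    refine ⟨u, us, rfl, fun x hx => ?_⟩
    obtain ⟨y, hy⟩ := T₁.nonempty_of_mem u (by simp [h])
    have hyT : y ∈ T₁.carrier := by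
      rw [T₁.carrier_eq_union, h]
      simp [hy]
    obtain ⟨a, ha, hya⟩ := Finset.mem_biUnion.1 (hcar ▸ hyT)
    rw [Finset.mem_Icc] at ha
    have := hle 1 a le_rfl ha.1 ha.2 x hx y hya
    rwa [(OSP.pos_eq_zero_iff h).2 hy, Nat.le_zero, OSP.pos_eq_zero_iff h] at this

theorem IsDisjointFamily.disjoint_biUnion {S : ℕ → Finset (Fin n)} {k i l : ℕ}
    (hS : IsDisjointFamily S k) (hil : i ≤ l) :
    Disjoint ((Finset.Icc 1 i).biUnion S) ((Finset.Icc (l + 1) k).biUnion S) := by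
  rw [Finset.disjoint_left]
  intro x hx hx'
  obtain ⟨a, ha, hxa⟩ := Finset.mem_biUnion.1 hx
  obtain ⟨b, hb, hxb⟩ := Finset.mem_biUnion.1 hx'
  rw [Finset.mem_Icc] at ha hb
  have := hS.eq_of_mem (Finset.mem_Icc.2 (by omega)) (Finset.mem_Icc.2 (by omega)) hxa hxb
  omega

theorem isDisjointFamily_of_blocks_eq {S : ℕ → Finset (Fin n)} {k l : ℕ} (hlk : l ≤ k) {P : OSP n}
    (hP : P.blocks = bentList S l k) : IsDisjointFamily S k := by
  have hmem : ∀ j ∈ Finset.Icc 1 k,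
      j ∈ (List.range' 1 l).reverse ++ List.range' (l + 1) (k - l) := by
    intro j hj
    rw [Finset.mem_Icc] at hj
    rw [List.mem_append, List.mem_reverse, List.mem_range'_1, List.mem_range'_1]
    omega
  refine ⟨fun a ha => P.nonempty_of_mem _ ?_, fun a ha b hb hab => ?_⟩
  · rw [hP]
    exact List.mem_map_of_mem (hmem a ha)
  · have h := P.disjoint
    rw [hP, bentList, List.pairwise_map] at h
    have : Std.Symm fun a b => Disjoint (S a) (S b) := ⟨fun _ _ h => h.symm⟩
    exact h.forall (hmem a ha) (hmem b hb) hab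

theorem biUnion_eq_carrier {S : ℕ → Finset (Fin n)} {k l : ℕ} (hlk : l ≤ k) {P : OSP n}
    (hP : P.blocks = bentList S l k) : (Finset.Icc 1 k).biUnion S = P.carrier := by
  ext x
  simp only [P.carrier_eq_union, BlockList.mem_union, hP, bentList, List.mem_map, List.mem_append,
    List.mem_reverse, List.mem_range'_1, Finset.mem_biUnion, Finset.mem_Icc]
  constructor
  · rintro ⟨j, hj, hx⟩
    exact ⟨S j, ⟨j, by omega, rfl⟩, hx⟩
  · rintro ⟨_, ⟨j, hj, rfl⟩, hx⟩
    exact ⟨j, by omega, hx⟩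

/-- A prefix (S_l, …, S_{j+1}) of the reversed part has sum Y_l - Y_j; every longer prefix
contributes Y_l plus a prefix sum of `vs`. -/
theorem nonneg_add_minPrefix_reverse_append_iff (x : Fin n → ℝ) (S : ℕ → Finset (Fin n))
    (vs : List (Finset (Fin n))) (l : ℕ) (s : ℝ) :
    0 ≤ s + BlockList.minPrefix x ((List.range' 1 l).reverse.map S ++ vs) ↔
      (∀ j ≤ l, 0 ≤ s + (partialSum x S l - partialSum x S j)) ∧
        0 ≤ s + partialSum x S l + BlockList.minPrefix x vs := by
  induction l generalizing s with
  | zero =>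
    have h0 : partialSum x S 0 = 0 := by simp [partialSum]
    have := BlockList.minPrefix_nonpos x vs
    simp only [List.range'_zero, List.reverse_nil, List.map_nil, List.nil_append, Nat.le_zero,
      forall_eq, sub_self, h0, add_zero]
    exact ⟨fun h => ⟨by linarith, h⟩, fun h => h.2⟩
  | succ l ih =>
    have hsucc : partialSum x S (l + 1) = partialSum x S l + ∑ i ∈ S (l + 1), x i :=
      Finset.sum_range_succ _ _
    rw [List.range'_concat, List.reverse_append, List.reverse_singleton, List.singleton_append,
      List.map_cons, List.cons_append, BlockList.minPrefix, nonneg_add_min_zero_iff, ← add_assoc,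
      one_mul, add_comm 1 l, ih]
    constructor
    · rintro ⟨h0, h1, h2⟩
      refine ⟨fun j hj => ?_, by linarith⟩
      rcases Nat.le_succ_iff.1 hj with hj | rfl
      · linarith [h1 j hj]
      · simpa using h0
    · rintro ⟨h1, h2⟩
      exact ⟨by simpa using h1 (l + 1) le_rfl, fun j hj => by linarith [h1 j (by omega)],
        by linarith⟩

theorem isComposite_insert {S : ℕ → Finset (Fin n)} {l k : ℕ} (hlk : l ≤ k)
    (hS : IsDisjointFamily S k) (hcover : (Finset.Icc 1 k).biUnion S = Finset.univ)
    {𝒯 : Finset (OSP n)} (h𝒯 : 𝒯 ∈ chainComposites S l) {T₁ : OSP n}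
    (hT₁ : T₁ ∈ 𝒯) {π : OSP n} (hπ : π ∈ orientedPlates S l k T₁) :
    π ∉ 𝒯.erase T₁ ∧ IsComposite (insert π (𝒯.erase T₁)) Finset.univ := by
  obtain ⟨hc, had⟩ := (mem_chainComposites (hS.mono hlk)).1 h𝒯
  obtain ⟨hd, hmem⟩ := isComposite_iff.1 hc
  have hcar := (mem_orientedPlates.1 hπ).1
  have hdisj : ∀ T ∈ 𝒯.erase T₁, Disjoint π.carrier T.carrier := by
    intro T hT
    obtain ⟨hne, hT⟩ := Finset.mem_erase.1 hT
    rw [hcar, Finset.disjoint_union_left]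
    refine ⟨hd T₁ hT₁ T hT hne.symm, ?_⟩
    exact (hS.disjoint_biUnion le_rfl).symm.mono_right fun x hx => (hmem x).2 ⟨T, hT, hx⟩
  refine ⟨fun h => π.carrier_nonempty.ne_empty
    (Finset.disjoint_self_iff_empty _ |>.1 (hdisj π h)), isComposite_iff.2 ⟨?_, ?_⟩⟩
  · intro T hT T' hT' hne
    rcases Finset.mem_insert.1 hT with h | h <;> rcases Finset.mem_insert.1 hT' with h' | h'
    · exact absurd (h.trans h'.symm) hne
    · exact h ▸ hdisj T' h'
    · exact h' ▸ (hdisj T h).symm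
    · exact hd T (Finset.mem_of_mem_erase h) T' (Finset.mem_of_mem_erase h') hne
  · refine fun x => iff_of_true (Finset.mem_univ x) ?_
    have hx : x ∈ (Finset.Icc 1 k).biUnion S := hcover ▸ Finset.mem_univ x
    obtain ⟨a, ha, hxa⟩ := Finset.mem_biUnion.1 hx
    rw [Finset.mem_Icc] at ha
    by_cases hal : a ≤ l
    · obtain ⟨T, hT, hxT⟩ := (hmem x).1
        (Finset.mem_biUnion.2 ⟨a, Finset.mem_Icc.2 ⟨ha.1, hal⟩, hxa⟩)
      by_cases hTT : T = T₁
      · refine ⟨π, Finset.mem_insert_self _ _, ?_⟩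
        rw [hcar, ← hTT]
        exact Finset.mem_union_left _ hxT
      · exact ⟨T, Finset.mem_insert_of_mem (Finset.mem_erase.2 ⟨hTT, hT⟩), hxT⟩
    · refine ⟨π, Finset.mem_insert_self _ _, ?_⟩
      rw [hcar]
      exact Finset.mem_union_right _
        (Finset.mem_biUnion.2 ⟨a, Finset.mem_Icc.2 (by omega), hxa⟩)

/-- The first block of each member contains the set `S_i` of smallest index among those meeting the
carrier, and the indices of these sets are at most `l` unless this smallest index is `1`. -/
theorem exists_head_of_mem_insert {S : ℕ → Finset (Fin n)} {l k : ℕ} (hl : 1 ≤ l) (hlk : l ≤ k)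
    (hS : IsDisjointFamily S k) {𝒯 : Finset (OSP n)} (h𝒯 : 𝒯 ∈ chainComposites S l) {T₁ : OSP n}
    (hT₁ : T₁ ∈ firstMembers S 𝒯) {π : OSP n} (hπ : π ∈ orientedPlates S l k T₁) {T : OSP n}
    (hT : T ∈ insert π (𝒯.erase T₁)) :
    ∃ B ∈ T.blocks.head?, ∃ i ∈ Finset.Icc 1 l, S i ⊆ B ∧
      ∀ x ∈ T.carrier, ∃ j ∈ Finset.Icc i k, x ∈ S j ∧ (i = 1 ∨ j ≤ l) := by
  obtain ⟨hc, had⟩ := (mem_chainComposites (hS.mono hlk)).1 h𝒯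
  obtain ⟨hd, hmem⟩ := isComposite_iff.1 hc
  obtain ⟨i₁, hi₁, hT₁c⟩ := exists_mem_initialChains hl (hS.mono hlk) h𝒯 hT₁
  rw [Finset.mem_Icc] at hi₁
  have hT₁car := (mem_initialChains.1 hT₁c).1
  rcases Finset.mem_insert.1 hT with rfl | hT
  · obtain ⟨u, us, hT₁b, hSu⟩ := exists_blocks_eq_of_mem_initialChains hT₁c
    obtain ⟨L, -, hTb⟩ := (mem_orientedPlates_iff_exists hl hlk hS hT₁b hSu
      (hT₁car ▸ hS.disjoint_biUnion hi₁.2)).1 hπ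
    refine ⟨u, by rw [hTb]; rfl, 1, Finset.mem_Icc.2 ⟨le_rfl, hl⟩, hSu, fun x hx => ?_⟩
    rw [(mem_orientedPlates.1 hπ).1, hT₁car, Finset.mem_union, Finset.mem_biUnion,
      Finset.mem_biUnion] at hx
    rcases hx with ⟨j, hj, hxj⟩ | ⟨j, hj, hxj⟩ <;> rw [Finset.mem_Icc] at hj <;>
      exact ⟨j, Finset.mem_Icc.2 (by omega), hxj, Or.inl rfl⟩
  · obtain ⟨hne, hT⟩ := Finset.mem_erase.1 hT
    obtain ⟨a, b, ha, hab, hbl, hcar⟩ :=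
      (had T hT).exists_carrier_eq fun x hx => (hmem x).2 ⟨T, hT, hx⟩
    cases hTb : T.blocks with
    | nil => exact absurd hTb T.ne_nil
    | cons B L =>
      refine ⟨B, rfl, a, Finset.mem_Icc.2 (by omega), fun x hx => ?_, fun x hx => ?_⟩
      · obtain ⟨y, hy⟩ := T.nonempty_of_mem B (by simp [hTb])
        have hyT : y ∈ T.carrier := by
          rw [T.carrier_eq_union, hTb]
          simp [hy]
        obtain ⟨c, hc, hyc⟩ := Finset.mem_biUnion.1 (hcar ▸ hyT)
        have hsub : ∀ j ∈ Finset.Icc a b, S j ⊆ T.carrier := fun j hj =>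
          hcar ▸ Finset.subset_biUnion_of_mem S hj
        have ha' : a ∈ Finset.Icc a b := Finset.mem_Icc.2 ⟨le_rfl, hab⟩
        have hc' := Finset.mem_Icc.1 hc
        have := (had T hT).pos_le a c ha hc'.1 (by omega) (hsub a ha') (hsub c hc) x hx y hyc
        rwa [(OSP.pos_eq_zero_iff hTb).2 hy, Nat.le_zero, OSP.pos_eq_zero_iff hTb] at this
      · obtain ⟨c, hc, hxc⟩ := Finset.mem_biUnion.1 (hcar ▸ hx)
        rw [Finset.mem_Icc] at hc
        exact ⟨c, Finset.mem_Icc.2 (by omega), hxc, Or.inr (by omega)⟩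

theorem isStandardFor_of_mem_insert {S : ℕ → Finset (Fin n)} {l k : ℕ} (hl : 1 ≤ l) (hlk : l ≤ k)
    (hS : IsDisjointFamily S k) {𝒯 : Finset (OSP n)} (h𝒯 : 𝒯 ∈ chainComposites S l) {T₁ : OSP n}
    (hT₁ : T₁ ∈ firstMembers S 𝒯) {π : OSP n} (hπ : π ∈ orientedPlates S l k T₁) {T : OSP n}
    (hT : T ∈ insert π (𝒯.erase T₁)) : T.IsStandardFor S k := by
  obtain ⟨B, hB, i, hi, hiB, hmem⟩ := exists_head_of_mem_insert hl hlk hS h𝒯 hT₁ hπ hT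
  refine ⟨B, hB, i, Finset.Icc_subset_Icc_right hlk hi, hiB, fun j hj hjT => ?_⟩
  obtain ⟨x, hx⟩ := hS.1 j hj
  obtain ⟨a, ha, hxa, -⟩ := hmem x (hjT hx)
  rw [Finset.mem_Icc] at ha hi
  rw [hS.eq_of_mem hj (Finset.mem_Icc.2 (by omega)) hx hxa]
  exact ha.1

theorem MinLT.trans {A B C : Finset (Fin n)} (hAB : MinLT A B) (hBC : MinLT B C) : MinLT A C := by
  obtain ⟨a, ha, hab⟩ := hAB
  obtain ⟨b, hb, hbc⟩ := hBC
  exact ⟨a, ha, fun c hc => (hab b hb).trans (hbc c hc)⟩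

/-- Sets with index above l occur only in π, whose lowest index is 1; so comparing their minima with
that of S_1 alone suffices. -/
theorem isStandard_of_mem_insert {S : ℕ → Finset (Fin n)} {l k : ℕ} (hl : 1 ≤ l) (hlk : l ≤ k)
    (hS : IsDisjointFamily S k) (hmin : ∀ i ∈ Finset.Ico 1 l, MinLT (S i) (S (i + 1)))
    (hmin' : ∀ j ∈ Finset.Icc (l + 1) k, MinLT (S 1) (S j)) {𝒯 : Finset (OSP n)}
    (h𝒯 : 𝒯 ∈ chainComposites S l) {T₁ : OSP n} (hT₁ : T₁ ∈ firstMembers S 𝒯) {π : OSP n}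
    (hπ : π ∈ orientedPlates S l k T₁) {T : OSP n} (hT : T ∈ insert π (𝒯.erase T₁)) :
    T.IsStandard := by
  obtain ⟨B, hB, i, hi, hiB, hmem⟩ := exists_head_of_mem_insert hl hlk hS h𝒯 hT₁ hπ hT
  have hne := hS.1 i (Finset.Icc_subset_Icc_right hlk hi)
  rw [Finset.mem_Icc] at hi
  have hlt : ∀ j, i + 1 ≤ j → j ≤ l → MinLT (S i) (S j) := by
    intro j hij
    induction j, hij using Nat.le_induction with
    | base => exact fun hil => hmin i (Finset.mem_Ico.2 (by omega))
    | succ j hij ih =>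
      exact fun hjl => (ih (by omega)).trans (hmin j (Finset.mem_Ico.2 (by omega)))
  refine ⟨B, hB, (S i).min' hne, hiB ((S i).min'_mem hne), fun x hx => ?_⟩
  obtain ⟨j, hj, hxj, hor⟩ := hmem x hx
  rw [Finset.mem_Icc] at hj
  rcases hj.1.eq_or_lt with rfl | hij
  · exact (S i).min'_le x hxj
  · have hmlt : MinLT (S i) (S j) := by
      by_cases hjl : j ≤ l
      · exact hlt j hij hjl
      · obtain rfl := hor.resolve_right hjl
        exact hmin' j (Finset.mem_Icc.2 (by omega))
    obtain ⟨a, ha, hax⟩ := hmlt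
    exact ((S i).min'_le a ha).trans (hax x hxj).le

theorem charFun_add_eq_convPlates {𝒯 : Finset (OSP n)} {π : OSP n} (h : π ∉ 𝒯) :
    charFun ((∑ T ∈ 𝒯, T.plate) + π.plate) = convPlates (insert π 𝒯) := by
  rw [convPlates, Finset.sum_insert h, add_comm]

theorem neg_one_zpow_add_sub (a b c d : ℕ) (h : c ≤ b) :
    (-1 : ℂ) ^ ((a : ℤ) + ((b : ℤ) - (c : ℤ)) - (d : ℤ)) = (-1) ^ (a + (b - c) + d) := by
  have hne : (-1 : ℂ) ≠ 0 := by norm_num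
  rw [← Nat.cast_sub h, ← Nat.cast_add, zpow_sub₀ hne, zpow_natCast, zpow_natCast, pow_add,
    div_eq_mul_inv, ← inv_pow, inv_neg, inv_one, pow_add _ (a + (b - c)), pow_add]

theorem charFun_plate_eq_sum {S : ℕ → Finset (Fin n)} {k l : ℕ} (hl : 1 ≤ l) (hlk : l ≤ k)
    {P : OSP n} (hP : P.blocks = bentList S l k) (hcover : P.carrier = Finset.univ) :
    charFun P.plate =
      ∑ 𝒯 ∈ chainComposites S l, ∑ T₁ ∈ firstMembers S 𝒯, ∑ π ∈ orientedPlates S l k T₁,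
        ((-1 : ℂ) ^ strictCount S l 𝒯 *
            (-1 : ℂ) ^ ((T₁.len : ℤ) + ((k : ℤ) - (l : ℤ)) - (π.len : ℤ))) •
          charFun ((∑ T ∈ 𝒯.erase T₁, T.plate) + π.plate) := by
  have hS := isDisjointFamily_of_blocks_eq hlk hP
  have hSl := hS.mono hlk
  have hunion : (Finset.Icc 1 k).biUnion S = Finset.univ := (biUnion_eq_carrier hlk hP).trans hcover
  funext x
  set vs := (List.range' (l + 1) (k - l)).map S with hvs
  set A' := (Finset.Icc (l + 1) k).biUnion S with hA'
  -- The value of the inner sum over π, written in terms of T₁ and the remaining members separately,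
  -- as `sum_chainComposites` requires. Every π has the same carrier, hence the same total
  -- condition.
  set Φ : OSP n → Finset (OSP n) → ℂ := fun T₁ 𝒯 =>
    (-1 : ℂ) ^ (T₁.len + 1) *
      ind (0 ≤ BlockList.minPrefix x vs + BlockList.minPrefixPos x T₁.blocks) *
      (ind (∑ i ∈ T₁.carrier, x i + ∑ i ∈ A', x i = 0) *
        ∏ T ∈ 𝒯, ((-1 : ℂ) ^ (T.len + 1) * plateInd x T)) with hΦ
  have hterm : ∀ 𝒯 ∈ chainComposites S l, ∀ T₁ ∈ firstMembers S 𝒯,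
      ∑ π ∈ orientedPlates S l k T₁,
        ((-1 : ℂ) ^ strictCount S l 𝒯 *
            (-1 : ℂ) ^ ((T₁.len : ℤ) + ((k : ℤ) - (l : ℤ)) - (π.len : ℤ))) *
          charFun ((∑ T ∈ 𝒯.erase T₁, T.plate) + π.plate) x = Φ T₁ (𝒯.erase T₁) := by
    intro 𝒯 h𝒯 T₁ hT₁
    have hT₁𝒯 := Finset.mem_of_mem_filter T₁ hT₁
    obtain ⟨i, hi, hT₁c⟩ := exists_mem_initialChains hl hSl h𝒯 hT₁
    rw [Finset.mem_Icc] at hi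
    obtain ⟨u, us, hT₁b, hSu⟩ := exists_blocks_eq_of_mem_initialChains hT₁c
    have hdisj : Disjoint T₁.carrier A' := by
      rw [(mem_initialChains.1 hT₁c).1]
      exact hS.disjoint_biUnion hi.2
    rw [hΦ]
    simp only
    rw [← sum_orientedPlates hl hlk hS hT₁b hSu hdisj x, Finset.mul_sum, Finset.sum_mul]
    refine Finset.sum_congr rfl fun π hπ => ?_
    obtain ⟨hnot, hcomp⟩ := isComposite_insert hlk hS hunion h𝒯 hT₁𝒯 hπ
    rw [charFun_add_eq_convPlates hnot, convPlates_apply hcomp, Finset.prod_insert hnot,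
      neg_one_pow_strictCount hSl h𝒯, ← Finset.mul_prod_erase 𝒯 _ hT₁𝒯,
      neg_one_zpow_add_sub _ _ _ _ hlk, Finset.prod_mul_distrib, plateInd,
      (mem_orientedPlates.1 hπ).1, Finset.sum_union hdisj]
    ring
  have hbB : BlockList.minPrefix x vs ≤ ∑ i ∈ A', x i := by
    rw [hA', ← union_map_range'_sub S hlk]
    exact (hS.isOrdered_map (by omega) (by omega)).minPrefix_le x
  have hsplit : ∑ i, x i = partialSum x S l + ∑ i ∈ A', x i := by
    rw [← hSl.sum_biUnion, ← Finset.sum_union (hS.disjoint_biUnion le_rfl), ← hunion]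
    congr 1
    ext y
    simp only [Finset.mem_union, Finset.mem_biUnion, Finset.mem_Icc]
    constructor
    · rintro ⟨a, ha, hy⟩
      by_cases hal : a ≤ l
      · exact Or.inl ⟨a, by omega, hy⟩
      · exact Or.inr ⟨a, by omega, hy⟩
    · rintro (⟨a, ha, hy⟩ | ⟨a, ha, hy⟩) <;> exact ⟨a, by omega, hy⟩
  -- The right-hand condition is the outcome of `sum_firstPassage`. Its missing case j = 0 follows
  -- from the nonpositivity of the prefix minimum of `vs`.
  have hleft : x ∈ P.plate ↔ (1 ≤ l ∧ partialSum x S l + ∑ i ∈ A', x i = 0 ∧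
      0 ≤ BlockList.minPrefix x vs + partialSum x S l ∧
      ∀ j, 1 ≤ j → j ≤ l → partialSum x S j ≤ partialSum x S l) := by
    have hrev := nonneg_add_minPrefix_reverse_append_iff x S vs l 0
    rw [zero_add, zero_add] at hrev
    have h0 : partialSum x S 0 = 0 := by simp [partialSum]
    have hnonpos := BlockList.minPrefix_nonpos x vs
    rw [OSP.mem_plate, hP, bentList, List.map_append, ← hvs, hrev, hcover, hsplit]
    constructor
    · rintro ⟨-, h1, h2, h3⟩
      exact ⟨hl, h1, by linarith, fun j _ hj => by linarith [h2 j hj]⟩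
    · rintro ⟨-, h1, h2, h3⟩
      refine ⟨fun i hi => absurd (Finset.mem_univ i) hi, h1, fun j hj => ?_, by linarith⟩
      rcases Nat.eq_zero_or_pos j with rfl | hj0
      · linarith
      · linarith [h3 j hj0 hj]
  simp only [Finset.sum_apply, Pi.smul_apply, smul_eq_mul]
  rw [Finset.sum_congr rfl fun 𝒯 h𝒯 => Finset.sum_congr rfl (hterm 𝒯 h𝒯),
    sum_chainComposites hl hSl Φ, charFun_apply, ind_congr hleft,
    ← sum_firstPassage (partialSum x S) l hbB]
  refine Finset.sum_congr rfl fun i hi => ?_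
  rw [Finset.mem_Icc] at hi
  rw [← (hSl.mono hi.2).sum_initialChains hi.1, Finset.sum_mul]
  refine Finset.sum_congr rfl fun T hT => ?_
  rw [hΦ]
  simp only
  rw [← Finset.mul_sum, ← Finset.mul_sum, sum_chainComposites_prod_plateInd (hSl.shift i),
    (mem_initialChains.1 hT).1, (hSl.mono hi.2).sum_biUnion,
    ind_congr (partialSum_shift_iff x S hi.2)]

end Main

theorem theorem6p1 (n k l : ℕ) (hl : 1 ≤ l) (hlk : l ≤ k) (S : ℕ → Finset (Fin n))
    (P : OSP n) (hP : P.blocks = bentList S l k) (hcover : P.carrier = Finset.univ) :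
    (charFun P.plate =
      ∑ 𝒯 ∈ chainComposites S l, ∑ T₁ ∈ firstMembers S 𝒯, ∑ π ∈ orientedPlates S l k T₁,
        ((-1 : ℂ) ^ strictCount S l 𝒯 *
            (-1 : ℂ) ^ ((T₁.len : ℤ) + ((k : ℤ) - (l : ℤ)) - (π.len : ℤ))) •
          charFun ((∑ T ∈ 𝒯.erase T₁, T.plate) + π.plate)) ∧
    (∀ 𝒯 ∈ chainComposites S l, ∀ T₁ ∈ firstMembers S 𝒯, ∀ π ∈ orientedPlates S l k T₁,
      IsComposite (insert π (𝒯.erase T₁)) Finset.univ ∧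
        ∀ T ∈ insert π (𝒯.erase T₁), T.IsStandardFor S k) ∧
    ((∀ i ∈ Finset.Ico 1 l, MinLT (S i) (S (i + 1))) →
      (∀ j ∈ Finset.Icc (l + 1) k, MinLT (S 1) (S j)) →
      ∀ 𝒯 ∈ chainComposites S l, ∀ T₁ ∈ firstMembers S 𝒯, ∀ π ∈ orientedPlates S l k T₁,
        charFun ((∑ T ∈ 𝒯.erase T₁, T.plate) + π.plate) ∈ canonicalBasis n) := by
  have hS := isDisjointFamily_of_blocks_eq hlk hP
  have hunion : (Finset.Icc 1 k).biUnion S = Finset.univ :=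
    (biUnion_eq_carrier hlk hP).trans hcover
  have hcomp : ∀ 𝒯 ∈ chainComposites S l, ∀ T₁ ∈ firstMembers S 𝒯,
      ∀ π ∈ orientedPlates S l k T₁,
        π ∉ 𝒯.erase T₁ ∧ IsComposite (insert π (𝒯.erase T₁)) Finset.univ :=
    fun 𝒯 h𝒯 T₁ hT₁ π hπ =>
      isComposite_insert hlk hS hunion h𝒯 (Finset.mem_of_mem_filter T₁ hT₁) hπ
  refine ⟨charFun_plate_eq_sum hl hlk hP hcover, ?_, ?_⟩
  · intro 𝒯 h𝒯 T₁ hT₁ π hπ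
    exact ⟨(hcomp 𝒯 h𝒯 T₁ hT₁ π hπ).2,
      fun T hT => isStandardFor_of_mem_insert hl hlk hS h𝒯 hT₁ hπ hT⟩
  · intro hmin hmin' 𝒯 h𝒯 T₁ hT₁ π hπ
    exact ⟨insert π (𝒯.erase T₁), (hcomp 𝒯 h𝒯 T₁ hT₁ π hπ).2,
      fun T hT => isStandard_of_mem_insert hl hlk hS hmin hmin' h𝒯 hT₁ hπ hT,
      charFun_add_eq_convPlates (hcomp 𝒯 h𝒯 T₁ hT₁ π hπ).1⟩
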